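/- Let $\mathbb T=\mathbb R/\mathbb Z$ with normalized Haar measure. Let $\Phi:\mathbb R\to\mathbb C$ be an even $C^\infty$ function with $\Phi(s)=1$ for $|s|\le 1$ and $\Phi(s)=0$ for $|s|\ge 2$. Put $\phi_0=\Phi$ and $\phi_k(s)=\Phi(2^{-k}s)-\Phi(2^{-k+1}s)$ for $k\ge 1$, and for a distribution $u$ on $\mathbb T$ with Fourier coefficients $\widehat u(n)=u(e^{-2\pi i n\,\cdot})$ put $L_ku(x)=\sum_{n\in\mathbb Z}\phi_k(n)\,\widehat u(n)\,e^{2\pi i n x}$, $k=0,1,2,\dots$. For $1<q\le 2$ let $B^\infty_{0,q}(\mathbb T)$ be the space of distributions $u$ on $\mathbb T$ for which $$\|u\|_{B^\infty_{0,q}}=\Big(\sum_{k=0}^\infty\|L_ku\|_\infty^q\Big)^{1/q}<\infty ,$$ and for $\nu>0$ let $\exp L^\nu(\mathbb T)$ be the space of measurable functions $f:\mathbb T\to\mathbb C$ (modulo equality almost everywhere) for which $$\|f\|_{\exp L^\nu}=\sup_{1\le p<\infty}p^{-1/\nu}\|f\|_{L^p(\mathbb T)}<\infty .$$ **Theorem.**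 Let $1<q\le 2$ and $q'=q/(q-1)$. Then $B^\infty_{0,q}(\mathbb T)$ is continuously embedded in $\exp L^{q'}(\mathbb T)$: there is a constant $C<\infty$, depending only on $q$ and $\Phi$, such that every $u\in B^\infty_{0,q}(\mathbb T)$ is given by an integrable function $f\in\exp L^{q'}(\mathbb T)$, i.e. $u(\varphi)=\int_{\mathbb T}f\varphi$ for all $\varphi\in C^\infty(\mathbb T)$, and $$\|f\|_{\exp L^{q'}}\le C\,\|u\|_{B^\infty_{0,q}} .$$ -/

import Mathlib

open MeasureTheory AddCircle
open scoped ENNReal NNReal ContDiff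

noncomputable section

namespace TorusBesov

/-- The space `C^∞(𝕋)` of complex valued smooth functions on `𝕋 = ℝ/ℤ`, i.e. those functions whose
`1`-periodic lift to `ℝ` is smooth. -/
def SmoothFun : Submodule ℂ (UnitAddCircle → ℂ) where
  carrier := {φ | ContDiff ℝ ∞ (fun x : ℝ => φ (x : UnitAddCircle))}
  add_mem' := by
    intro f g hf hg
    rw [Set.mem_ofPred_eq] at hf hg ⊢
    exact hf.add hg
  zero_mem' := by
    rw [Set.mem_ofPred_eq]
    exact contDiff_const
  smul_mem' := by
    intro c f hf
    rw [Set.mem_ofPred_eq] at hf ⊢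
    exact hf.const_smul c

/-- The space `𝒟'(𝕋)` of distributions on `𝕋`: the linear functionals `u` on `C^∞(𝕋)` that are
continuous, i.e. for which there are `N` and `C` with
`|u(φ)| ≤ C max_{j ≤ N} sup_x |φ^{(j)}(x)|` for all `φ ∈ C^∞(𝕋)`. -/
def Distribution : Submodule ℂ (SmoothFun →ₗ[ℂ] ℂ) where
  carrier := {u | ∃ (N : ℕ) (C : ℝ), ∀ (φ : SmoothFun) (B : ℝ),
    (∀ j ≤ N, ∀ x : ℝ,
      ‖iteratedDeriv j (fun y : ℝ => (φ : UnitAddCircle → ℂ) (y : UnitAddCircle)) x‖ ≤ B) →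
    ‖u φ‖ ≤ C * B}
  add_mem' := by
    rintro u v ⟨N, C, hu⟩ ⟨M, D, hv⟩
    refine ⟨max N M, C + D, fun φ B hB => ?_⟩
    have h1 := hu φ B fun j hj => hB j (hj.trans (le_max_left _ _))
    have h2 := hv φ B fun j hj => hB j (hj.trans (le_max_right _ _))
    calc ‖(u + v) φ‖ ≤ ‖u φ‖ + ‖v φ‖ := norm_add_le _ _
      _ ≤ (C + D) * B := by linarith
  zero_mem' := ⟨0, 0, fun φ B _ => by simp⟩
  smul_mem' := by
    rintro c u ⟨N, C, hu⟩
    refine ⟨N, ‖c‖ * C, fun φ B hB => ?_⟩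
    rw [LinearMap.smul_apply, norm_smul, mul_assoc]
    exact mul_le_mul_of_nonneg_left (hu φ B hB) (norm_nonneg c)

/-- The exponential `x ↦ e^{2πinx}` as an element of `C^∞(𝕋)`. -/
def expFun (n : ℤ) : SmoothFun :=
  ⟨fun x => fourier n x, by
    change ContDiff ℝ ∞ (fun x : ℝ => (fourier n (x : UnitAddCircle) : ℂ))
    simp only [fourier_coe_apply]
    have h : ContDiff ℝ ∞ (fun x : ℝ => (x : ℂ)) := Complex.ofRealCLM.contDiff
    fun_prop⟩

/-- The Fourier coefficient `û(n) = u(e^{-2πin·})` of a distribution. -/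
def coeff (u : Distribution) (n : ℤ) : ℂ := u.1 (expFun (-n))

/-- The admissible cut-offs: even `C^∞` functions on `ℝ`, equal to `1` on `[-1,1]` and vanishing
outside `(-2,2)`. -/
structure IsCutoff (Φ : ℝ → ℂ) : Prop where
  smooth : ContDiff ℝ ∞ Φ
  even : ∀ s, Φ (-s) = Φ s
  eq_one : ∀ s, |s| ≤ 1 → Φ s = 1
  support_subset : Function.support Φ ⊆ Set.Ioo (-2) 2

/-- The dyadic multipliers: `φ₀ = Φ` and `φ_k(s) = Φ(2^{-k} s) - Φ(2^{-k+1} s)` for `k ≥ 1`. -/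
def dyadic (Φ : ℝ → ℂ) : ℕ → ℝ → ℂ
  | 0, s => Φ s
  | k + 1, s => Φ (s / 2 ^ (k + 1)) - Φ (s / 2 ^ k)

/-- The trigonometric polynomial `L_k u(x) = ∑_n φ_k(n) û(n) e^{2πinx}`; for a cut-off `Φ` only
finitely many terms are nonzero. -/
def lpPiece (Φ : ℝ → ℂ) (k : ℕ) (u : Distribution) (x : UnitAddCircle) : ℂ :=
  ∑' n : ℤ, dyadic Φ k n * coeff u n * fourier n x

/-- The norm `(∑_k ‖L_k u‖_∞^q)^{1/q}` of `B^∞_{0,q}(𝕋)`, with values in `[0,∞]`. -/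
def besovNorm (Φ : ℝ → ℂ) (q : ℝ) (u : Distribution) : ℝ≥0∞ :=
  (∑' k : ℕ, eLpNorm (lpPiece Φ k u) ⊤ haarAddCircle ^ q) ^ (1 / q)

/-- The space `B^∞_{0,q}(𝕋)`. -/
def besovSpace (Φ : ℝ → ℂ) (q : ℝ) : Set Distribution := {u | besovNorm Φ q u < ⊤}

/-- The norm `sup_{1 ≤ p < ∞} p^{-1/ν} ‖f‖_p` of `exp L^ν(𝕋)`, with values in `[0,∞]`. -/
def expLNorm (ν : ℝ) (f : UnitAddCircle → ℂ) : ℝ≥0∞ :=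
  ⨆ (p : ℝ) (_ : 1 ≤ p),
    ENNReal.ofReal (p ^ (-(1 / ν))) * eLpNorm f (ENNReal.ofReal p) haarAddCircle

/-- Membership of a function in `exp L^ν(𝕋)`. -/
def MemExpL (ν : ℝ) (f : UnitAddCircle → ℂ) : Prop :=
  AEStronglyMeasurable f haarAddCircle ∧ expLNorm ν f < ⊤

/-- The distribution `u` is (given by) the integrable function `f`. -/
def IsGivenBy (u : Distribution) (f : UnitAddCircle → ℂ) : Prop :=
  Integrable f haarAddCircle ∧
    ∀ φ : SmoothFun, u.1 φ = ∫ x, f x * (φ : UnitAddCircle → ℂ) x ∂haarAddCircle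

end TorusBesov

end

/-!
Let `a_k = ‖L_k u‖_∞`. The embedding rests on an estimate for finite sums of Littlewood–Paley
pieces, `integral_norm_sum_rpow_le`: for any finite set of indices,
`‖∑ L_k u‖_p ≤ C p^{1/q'} (∑ a_k^q)^{1/q}`, with `C` an absolute constant.

The estimate comes from a comparison with dyadic martingales. Write `A_j f` for the average of `f`
over dyadic intervals of length `2^{-j}`. Since `L_k u` has its frequencies in
`2^{k-1} ≤ |n| ≤ 2^{k+1}` (in `|n| ≤ 2` if `k = 0`), its martingale difference at scale `2^{-j}` is at most
`C 2^{-|j-k|} a_k` (`norm_dyAvg_succ_sub_le`): for `j ≥ k` because of Bernstein's inequality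
`norm_deriv_trigPoly_le`, and for `j < k` because `L_k u` has an antiderivative of size
`C 2^{-k} a_k`, by the inverse inequality `norm_trigPoly_le_of_norm_deriv_le`. Both inequalities
are obtained from the Fejér kernel. Thus the martingale differences `b_j` of the sum satisfy
`‖b‖_q ≤ C ‖a‖_q`, by Young's inequality.

On the binary tree the differences come in pairs `±d`, so the Azuma–Hoeffding argument applies; as
`cosh x ≤ exp |x|^q` for `1 ≤ q ≤ 2`, it gives `∫ exp(r |f|) ≤ C exp(C r ‖a‖_q + (C r ‖a‖_q)^q)`
(`integral_exp_norm_le`). The choice `r = p^{1/q} / ‖a‖_q` and `t^p ≤ (p / r)^p e^{rt}` turn this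
into the bound `C p^{1 - 1/q} ‖a‖_q` for the `L^p` norm.

Applied with `p = 2` to the tails, the estimate shows that `∑ L_k u` converges in `L²` to some `f`;
Fatou's lemma gives the `L^p` bounds for `f`. The Fourier coefficients of `f` are those of `u`
because `∑ φ_k = 1`, and a distribution is determined by its Fourier coefficients
(`distribution_ext_coeff`), the Fourier series of a smooth function being convergent in `C^∞(𝕋)`.
-/

noncomputable section

namespace TorusBesov

/-! ### Exponentials and trigonometric polynomials on the line -/

/-- The exponential `x ↦ e^{2πinx}` as a function on the real line. -/
def expo (n : ℤ) (x : ℝ) : ℂ := Complex.exp (2 * Real.pi * Complex.I * n * x)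

lemma fourier_eq_expo (n : ℤ) (x : ℝ) : fourier n (x : UnitAddCircle) = expo n x := by
  rw [fourier_coe_apply, expo]
  simp

@[simp] lemma expo_zero_left (x : ℝ) : expo 0 x = 1 := by simp [expo]

lemma expo_add_left (m n : ℤ) (x : ℝ) : expo (m + n) x = expo m x * expo n x := by
  rw [expo, expo, expo, ← Complex.exp_add]
  push_cast
  ring_nf

lemma expo_sub_right (n : ℤ) (x y : ℝ) : expo n (x - y) = expo n x * expo (-n) y := by
  rw [expo, expo, expo, ← Complex.exp_add]
  push_cast
  ring_nf

@[simp] lemma norm_expo (n : ℤ) (x : ℝ) : ‖expo n x‖ = 1 := by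
  rw [expo, show (2 * Real.pi * Complex.I * n * x : ℂ) = ((2 * Real.pi * n * x : ℝ) : ℂ) * Complex.I
    by push_cast; ring]
  exact Complex.norm_exp_ofReal_mul_I _

lemma conj_expo (n : ℤ) (x : ℝ) : (starRingEnd ℂ) (expo n x) = expo (-n) x := by
  rw [expo, expo, ← Complex.exp_conj]
  simp only [map_mul, Complex.conj_ofReal, Complex.conj_I, map_intCast, map_ofNat]
  push_cast
  ring_nf

lemma hasDerivAt_expo (n : ℤ) (x : ℝ) :
    HasDerivAt (expo n) (2 * Real.pi * Complex.I * n * expo n x) x := by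
  have h : HasDerivAt (fun y : ℝ => 2 * Real.pi * Complex.I * n * (y : ℂ))
      (2 * Real.pi * Complex.I * n) x := by
    simpa using (Complex.ofRealCLM.hasDerivAt (x := x)).const_mul (2 * Real.pi * Complex.I * n : ℂ)
  exact h.cexp.congr_deriv (mul_comm _ _)

@[fun_prop] lemma continuous_expo (n : ℤ) : Continuous (expo n) := by
  unfold expo
  fun_prop

lemma integral_expo (n : ℤ) :
    ∫ t in (-(1 / 2) : ℝ)..(1 / 2), expo n t = if n = 0 then 1 else 0 := by
  split_ifs with h
  · subst h
    simp
    norm_num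
  · have hc : (2 * Real.pi * Complex.I * n : ℂ) ≠ 0 := by
      simp [Real.pi_ne_zero, h, Complex.I_ne_zero]
    simp only [expo]
    rw [integral_exp_mul_complex hc, div_eq_zero_iff]
    left
    rw [sub_eq_zero, Complex.exp_eq_exp_iff_exists_int]
    exact ⟨n, by push_cast; ring⟩

/-- The trigonometric polynomial with frequencies in `s` and coefficients `c`. -/
def trigPoly (s : Finset ℤ) (c : ℤ → ℂ) (x : ℝ) : ℂ := ∑ n ∈ s, c n * expo n x

@[fun_prop] lemma continuous_trigPoly (s : Finset ℤ) (c : ℤ → ℂ) : Continuous (trigPoly s c) := by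
  unfold trigPoly
  fun_prop

lemma hasDerivAt_trigPoly (s : Finset ℤ) (c : ℤ → ℂ) (x : ℝ) :
    HasDerivAt (trigPoly s c) (trigPoly s (fun n => 2 * Real.pi * Complex.I * n * c n) x) x := by
  have := HasDerivAt.fun_sum (u := s) (A := fun n x => c n * expo n x)
    fun n _ => (hasDerivAt_expo n x).const_mul (c n)
  refine this.congr_deriv (Finset.sum_congr rfl fun n _ => ?_)
  ring

lemma norm_trigPoly_le (s : Finset ℤ) (c : ℤ → ℂ) (x : ℝ) : ‖trigPoly s c x‖ ≤ ∑ n ∈ s, ‖c n‖ :=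
  (norm_sum_le _ _).trans_eq (Finset.sum_congr rfl fun n _ => by simp)

/-! ### The Fejér kernel -/

/-- The Fejér kernel `n⁻¹ |∑_{k < n} e^{2πikt}|²`. -/
def fejer (n : ℕ) (t : ℝ) : ℝ := ‖∑ k ∈ Finset.range n, expo k t‖ ^ 2 / n

lemma fejer_nonneg (n : ℕ) (t : ℝ) : 0 ≤ fejer n t := by
  unfold fejer
  positivity

@[fun_prop] lemma continuous_fejer (n : ℕ) : Continuous (fejer n) := by
  unfold fejer
  fun_prop

lemma ofReal_fejer (n : ℕ) (t : ℝ) :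
    (fejer n t : ℂ) = (∑ k ∈ Finset.range n, ∑ l ∈ Finset.range n, expo (k - l) t) / n := by
  unfold fejer
  push_cast
  rw [← Complex.mul_conj', map_sum, Finset.sum_mul_sum]
  simp_rw [conj_expo, ← expo_add_left, sub_eq_add_neg]

/-- The Fourier coefficients of the Fejér kernel are `max (1 - |m| / n) 0`: the `m`-th one counts
the pairs `k, l < n` with `l - k = m`. -/
lemma integral_expo_mul_fejer (n : ℕ) (m : ℤ) :
    ∫ t in (-(1 / 2) : ℝ)..(1 / 2), expo m t * fejer n t
      = ((n - |m| : ℤ) ⊔ 0 : ℤ) / n := by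
  have h1 : ∀ t, expo m t * fejer n t
      = ∑ k ∈ Finset.range n, ∑ l ∈ Finset.range n, expo (m + (k - l)) t / n := by
    intro t
    rw [ofReal_fejer, mul_div_assoc', Finset.mul_sum, Finset.sum_div]
    refine Finset.sum_congr rfl fun k _ => ?_
    rw [Finset.mul_sum, Finset.sum_div]
    exact Finset.sum_congr rfl fun l _ => by rw [expo_add_left]
  simp_rw [h1]
  rw [intervalIntegral.integral_finsetSum
    fun k _ => (Continuous.intervalIntegrable (by fun_prop) _ _)]
  have h2 : ∀ k ∈ Finset.range n, ∫ t in (-(1 / 2) : ℝ)..(1 / 2),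
      ∑ l ∈ Finset.range n, expo (m + (k - l)) t / n
      = (if 0 ≤ m + k ∧ m + k < n then 1 else 0) / n := by
    intro k _
    rw [intervalIntegral.integral_finsetSum
      fun k _ => (Continuous.intervalIntegrable (by fun_prop) _ _)]
    simp_rw [intervalIntegral.integral_div, integral_expo]
    rw [← Finset.sum_div]
    congr 1
    split_ifs with h
    · rw [Finset.sum_eq_single (m + k).toNat]
      · rw [if_pos (by omega)]
      · intro b _ hb
        rw [if_neg (by omega)]
      · intro hb
        rw [Finset.mem_range] at hb
        omega
    · refine Finset.sum_eq_zero fun l hl => ?_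
      rw [Finset.mem_range] at hl
      rw [if_neg (by omega)]
  rw [Finset.sum_congr rfl h2, ← Finset.sum_div, Finset.sum_boole]
  congr 1
  have h3 : (Finset.range n).filter (fun k : ℕ => 0 ≤ m + k ∧ m + k < n)
      = Finset.Ico (-m).toNat (min n (n - m).toNat) := by
    ext k
    simp only [Finset.mem_filter, Finset.mem_range, Finset.mem_Ico]
    omega
  rw [h3, Nat.card_Ico]
  have h4 : ((min n (n - m).toNat - (-m).toNat : ℕ) : ℤ) = (n - |m|) ⊔ 0 := by
    rcases abs_cases m with ⟨h, _⟩ | ⟨h, _⟩ <;> rw [h] <;> omega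
  rw [← h4]
  push_cast
  rfl

lemma integral_fejer {n : ℕ} (hn : n ≠ 0) : ∫ t in (-(1 / 2) : ℝ)..(1 / 2), fejer n t = 1 := by
  have h := integral_expo_mul_fejer n 0
  simp only [expo_zero_left, one_mul, intervalIntegral.integral_ofReal] at h
  have h2 : ((∫ t in (-(1 / 2) : ℝ)..(1 / 2), fejer n t : ℝ) : ℂ) = (1 : ℝ) := by
    rw [h]
    simp [hn]
  exact_mod_cast h2

lemma four_mul_abs_le_norm_expo_sub_one {t : ℝ} (ht : |t| ≤ 1 / 2) : 4 * |t| ≤ ‖expo 1 t - 1‖ := by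
  have h : ‖expo 1 t - 1‖ = ‖2 * Real.sin (2 * Real.pi * t / 2)‖ := by
    rw [← Complex.norm_exp_I_mul_ofReal_sub_one, expo]
    congr 3
    push_cast
    ring
  rw [h, norm_mul, Real.norm_eq_abs, Real.norm_eq_abs, abs_two,
    show 2 * Real.pi * t / 2 = Real.pi * t by ring]
  have h2 := Real.mul_abs_le_abs_sin (x := Real.pi * t) (by
    rw [abs_mul, abs_of_pos Real.pi_pos]
    nlinarith [Real.pi_pos])
  rw [abs_mul, abs_of_pos Real.pi_pos] at h2
  have h3 : 2 / Real.pi * (Real.pi * |t|) = 2 * |t| := by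
    field_simp
  linarith

/-- Away from the origin the Fejér kernel decays quadratically at scale `1 / n`. -/
lemma fejer_mul_sq_le {n : ℕ} (hn : n ≠ 0) {t : ℝ} (ht : |t| ≤ 1 / 2) :
    fejer n t * t ^ 2 ≤ 1 / (4 * n) := by
  have hgeom : (∑ k ∈ Finset.range n, expo k t) * (expo 1 t - 1) = expo n t - 1 := by
    have : ∀ k : ℕ, expo k t = expo 1 t ^ k := by
      intro k
      rw [expo, expo, ← Complex.exp_nat_mul]
      congr 1
      push_cast
      ring
    simp_rw [this]
    exact geom_sum_mul _ _
  have h1 := four_mul_abs_le_norm_expo_sub_one ht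
  have h2 : ‖∑ k ∈ Finset.range n, expo k t‖ * ‖expo 1 t - 1‖ ≤ 2 := by
    rw [← norm_mul, hgeom]
    refine (norm_sub_le _ _).trans ?_
    simp
    norm_num
  have h3 : ‖∑ k ∈ Finset.range n, expo k t‖ * (4 * |t|) ≤ 2 :=
    (mul_le_mul_of_nonneg_left h1 (norm_nonneg _)).trans h2
  have h4 : (‖∑ k ∈ Finset.range n, expo k t‖ * |t|) ^ 2 ≤ (1 / 2) ^ 2 := by
    gcongr
    linarith
  rw [mul_pow, sq_abs] at h4
  have hn' : (0 : ℝ) < n := by positivity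
  unfold fejer
  rw [div_mul_eq_mul_div, div_le_div_iff₀ hn' (by positivity)]
  nlinarith

/-! ### Bernstein's inequality and its inverse -/

/-- Integration of a translate of a trigonometric polynomial against a kernel acts on the
coefficients as the multiplier given by the kernel. -/
lemma integral_trigPoly_sub_mul (s : Finset ℤ) (c : ℤ → ℂ) {K : ℝ → ℂ} (hK : Continuous K) (x : ℝ) :
    ∫ t in (-(1 / 2) : ℝ)..(1 / 2), trigPoly s c (x - t) * K t
      = trigPoly s (fun m => c m * ∫ t in (-(1 / 2) : ℝ)..(1 / 2), expo (-m) t * K t) x := by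
  have h : ∀ t, trigPoly s c (x - t) * K t = ∑ m ∈ s, (c m * expo m x) * (expo (-m) t * K t) := by
    intro t
    rw [trigPoly, Finset.sum_mul]
    refine Finset.sum_congr rfl fun m _ => ?_
    rw [expo_sub_right]
    ring
  simp_rw [h]
  rw [intervalIntegral.integral_finsetSum
    fun k _ => (Continuous.intervalIntegrable (by fun_prop) _ _)]
  refine Finset.sum_congr rfl fun m _ => ?_
  rw [intervalIntegral.integral_const_mul]
  ring

/-- **Bernstein's inequality**, with a non-optimal constant. On frequencies `|m| ≤ n` the
multiplier `m` is that of the kernel `n (e^{2πint} - e^{-2πint}) F_n(t)`, with `F_n` the Fejér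
kernel. -/
lemma norm_deriv_trigPoly_le {n : ℕ} (hn : n ≠ 0) {s : Finset ℤ} (hs : ∀ m ∈ s, |m| ≤ n)
    (c : ℤ → ℂ) {a : ℝ} (ha : ∀ x, ‖trigPoly s c x‖ ≤ a) (x : ℝ) :
    ‖trigPoly s (fun m => 2 * Real.pi * Complex.I * m * c m) x‖ ≤ 4 * Real.pi * n * a := by
  have hn' : (n : ℂ) ≠ 0 := by exact_mod_cast hn
  set K : ℝ → ℂ := fun t => 2 * Real.pi * Complex.I * n * ((expo n t - expo (-n) t) * fejer n t)
    with hKdef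
  have hKc : Continuous K := by fun_prop
  have hcoef : ∀ m ∈ s, ∫ t in (-(1 / 2) : ℝ)..(1 / 2), expo (-m) t * K t
      = 2 * Real.pi * Complex.I * m := by
    intro m hm
    have h : ∀ t, expo (-m) t * K t = 2 * Real.pi * Complex.I * n *
        (expo (-m + n) t * fejer n t - expo (-m + -n) t * fejer n t) := by
      intro t
      rw [hKdef, expo_add_left, expo_add_left]
      ring
    simp_rw [h]
    rw [intervalIntegral.integral_const_mul, intervalIntegral.integral_sub
      (Continuous.intervalIntegrable (by fun_prop) _ _)
      (Continuous.intervalIntegrable (by fun_prop) _ _),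
      integral_expo_mul_fejer, integral_expo_mul_fejer, ← sub_div, ← Int.cast_sub]
    have h2 : ((n - |-m + n| : ℤ) ⊔ 0) - ((n - |-m + -n| : ℤ) ⊔ 0) = m := by
      have := abs_le.mp (hs m hm)
      rcases abs_cases (-m + n : ℤ) with ⟨h, _⟩ | ⟨h, _⟩ <;>
      rcases abs_cases (-m + -n : ℤ) with ⟨h', _⟩ | ⟨h', _⟩ <;> rw [h, h'] <;> omega
    rw [h2]
    field_simp
  have hrep : trigPoly s (fun m => 2 * Real.pi * Complex.I * m * c m) x
      = ∫ t in (-(1 / 2) : ℝ)..(1 / 2), trigPoly s c (x - t) * K t := by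
    rw [integral_trigPoly_sub_mul s c hKc]
    refine Finset.sum_congr rfl fun m hm => ?_
    dsimp only
    rw [hcoef m hm]
    ring
  rw [hrep]
  have hbound : ∀ t, ‖trigPoly s c (x - t) * K t‖ ≤ 4 * Real.pi * n * a * fejer n t := by
    intro t
    have h1 : ‖K t‖ ≤ 4 * Real.pi * n * fejer n t := by
      rw [hKdef]
      simp only [norm_mul, Complex.norm_I, Complex.norm_real, Complex.norm_natCast,
        Complex.norm_ofNat, Real.norm_eq_abs, abs_of_pos Real.pi_pos, abs_of_nonneg (fejer_nonneg n t)]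
      have h2 : ‖expo n t - expo (-n) t‖ ≤ 2 := by
        refine (norm_sub_le _ _).trans ?_
        simp
        norm_num
      have h3 := mul_le_mul_of_nonneg_left h2 (show 0 ≤ 2 * Real.pi * n * fejer n t by
        have := fejer_nonneg n t
        positivity)
      linarith
    have ha0 : 0 ≤ a := (norm_nonneg _).trans (ha x)
    rw [norm_mul]
    calc _ ≤ a * (4 * Real.pi * n * fejer n t) := by gcongr; exact ha _
      _ = _ := by ring
  refine (intervalIntegral.norm_integral_le_of_norm_le (by norm_num)
    (Filter.Eventually.of_forall fun t _ => hbound t)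
    (Continuous.intervalIntegrable (by fun_prop) _ _)).trans ?_
  rw [intervalIntegral.integral_const_mul, integral_fejer hn, mul_one]

/-- The inverse Bernstein inequality (Bohr, Favard), with a non-optimal constant: a trigonometric
polynomial with frequencies `|m| ≥ n` is controlled by its derivative divided by `n`. Such a
polynomial `T` is annihilated by the Fejér kernel `F_n`, hence
`T(x) = ∫ (T(x) - T(x-t)) F_n(t) dt`; the tail `|t| ≥ 2π/n` carries so little mass of `F_n` that
its contribution is at most half the supremum of `|T|`. -/
lemma norm_trigPoly_le_of_norm_deriv_le {n : ℕ} (hn : n ≠ 0) {s : Finset ℤ}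
    (hs : ∀ m ∈ s, (n : ℤ) ≤ |m|) (c : ℤ → ℂ) {a : ℝ}
    (ha : ∀ x, ‖trigPoly s (fun m => 2 * Real.pi * Complex.I * m * c m) x‖ ≤ a) (x : ℝ) :
    ‖trigPoly s c x‖ ≤ 4 * Real.pi * a / n := by
  have hn' : (0 : ℝ) < n := by positivity
  have ha0 : 0 ≤ a := (norm_nonneg _).trans (ha x)
  have hbdd : BddAbove (Set.range fun x => ‖trigPoly s c x‖) :=
    ⟨_, Set.forall_mem_range.2 fun x => norm_trigPoly_le s c x⟩
  set M := ⨆ x, ‖trigPoly s c x‖ with hM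
  have hTM : ∀ y, ‖trigPoly s c y‖ ≤ M := fun y => le_ciSup hbdd y
  have hM0 : 0 ≤ M := (norm_nonneg _).trans (hTM x)
  -- With this `δ` the majorant `M / n * (δ² + t²)⁻¹` of the tail has total mass at most `M / 2`.
  set δ : ℝ := 2 * Real.pi / n with hδ
  have hδ0 : 0 < δ := by positivity
  have hlip : ∀ y t, ‖trigPoly s c y - trigPoly s c (y - t)‖ ≤ a * |t| := by
    intro y t
    have := convex_univ.norm_image_sub_le_of_norm_hasDerivWithin_le (𝕜 := ℝ) (C := a)
      (f := trigPoly s c) (fun x _ => (hasDerivAt_trigPoly s c x).hasDerivWithinAt)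
      (fun x _ => ha x) (Set.mem_univ (y - t)) (Set.mem_univ y)
    simpa using this
  have hzero : ∀ y, ∫ t in (-(1 / 2) : ℝ)..(1 / 2), trigPoly s c (y - t) * fejer n t = 0 := by
    intro y
    rw [integral_trigPoly_sub_mul s c (K := fun t => fejer n t) (by fun_prop)]
    refine Finset.sum_eq_zero fun m hm => ?_
    dsimp only
    rw [integral_expo_mul_fejer, abs_neg, max_eq_right (by linarith [hs m hm])]
    simp
  have hrep : ∀ y, trigPoly s c y = ∫ t in (-(1 / 2) : ℝ)..(1 / 2),
      (trigPoly s c y - trigPoly s c (y - t)) * fejer n t := by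
    intro y
    simp_rw [sub_mul]
    rw [intervalIntegral.integral_sub
      (Continuous.intervalIntegrable (by fun_prop) _ _)
      (Continuous.intervalIntegrable (by fun_prop) _ _), hzero, sub_zero,
      intervalIntegral.integral_const_mul, intervalIntegral.integral_ofReal, integral_fejer hn]
    simp
  have hbound : ∀ y, ∀ t ∈ Set.Ioc (-(1 / 2) : ℝ) (1 / 2),
      ‖(trigPoly s c y - trigPoly s c (y - t)) * fejer n t‖
        ≤ a * δ * fejer n t + M / n * (δ ^ 2 + t ^ 2)⁻¹ := by
    intro y t ht
    rw [norm_mul, Complex.norm_real, Real.norm_eq_abs, abs_of_nonneg (fejer_nonneg n t)]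
    have hF := fejer_nonneg n t
    rcases le_total |t| δ with h | h
    · have h1 : ‖trigPoly s c y - trigPoly s c (y - t)‖ ≤ a * δ :=
        (hlip y t).trans (mul_le_mul_of_nonneg_left h ha0)
      have h2 : 0 ≤ M / n * (δ ^ 2 + t ^ 2)⁻¹ := by positivity
      nlinarith [mul_le_mul_of_nonneg_right h1 hF]
    · have h1 : ‖trigPoly s c y - trigPoly s c (y - t)‖ ≤ 2 * M := by
        refine (norm_sub_le _ _).trans ?_
        linarith [hTM y, hTM (y - t)]
      have ht2 : δ ^ 2 ≤ t ^ 2 := by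
        rw [← sq_abs t]
        gcongr
      have h2 : fejer n t ≤ 1 / (2 * n) * (δ ^ 2 + t ^ 2)⁻¹ := by
        rw [← div_eq_mul_inv, le_div_iff₀ (by positivity)]
        have h3 := fejer_mul_sq_le hn (t := t) (abs_le.2 ⟨ht.1.le, ht.2⟩)
        have h4 : fejer n t * (δ ^ 2 + t ^ 2) ≤ 2 * (fejer n t * t ^ 2) := by nlinarith
        have h5 : (1 : ℝ) / (2 * n) = 2 * (1 / (4 * n)) := by
          field_simp
          norm_num
        linarith
      have h3 : 0 ≤ a * δ * fejer n t := by positivity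
      calc _ ≤ 2 * M * (1 / (2 * n) * (δ ^ 2 + t ^ 2)⁻¹) := by gcongr
        _ = M / n * (δ ^ 2 + t ^ 2)⁻¹ := by
          field_simp
        _ ≤ _ := by linarith
  have hcont : Continuous fun t : ℝ => (δ ^ 2 + t ^ 2)⁻¹ :=
    Continuous.inv₀ (by fun_prop) fun t => by positivity
  have hkey : ∀ y, ‖trigPoly s c y‖ ≤ a * δ + M / 2 := by
    intro y
    rw [hrep y]
    refine (intervalIntegral.norm_integral_le_of_norm_le (by norm_num)
      (Filter.Eventually.of_forall fun t ht => hbound y t ht)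
      (Continuous.intervalIntegrable (by fun_prop) _ _)).trans ?_
    rw [intervalIntegral.integral_add (Continuous.intervalIntegrable (by fun_prop) _ _)
      (Continuous.intervalIntegrable (by fun_prop) _ _), intervalIntegral.integral_const_mul,
      intervalIntegral.integral_const_mul, integral_fejer hn, mul_one,
      integral_inv_sq_add_sq hδ0.ne']
    have h1 := Real.arctan_lt_pi_div_two (1 / 2 / δ)
    have h2 := Real.neg_pi_div_two_lt_arctan (-(1 / 2) / δ)
    have h3 : M / n * (δ⁻¹ * (Real.arctan (1 / 2 / δ) - Real.arctan (-(1 / 2) / δ)))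
        ≤ M / n * (δ⁻¹ * Real.pi) := by
      gcongr
      linarith
    have h4 : M / n * (δ⁻¹ * Real.pi) = M / 2 := by
      rw [hδ]
      field_simp
    linarith
  -- As `M` is finite, the term `M / 2` can be absorbed.
  have hfin : M ≤ a * δ + M / 2 := ciSup_le hkey
  calc ‖trigPoly s c x‖ ≤ M := hTM x
    _ ≤ 2 * (a * δ) := by linarith
    _ = 4 * Real.pi * a / n := by
      rw [hδ]
      ring

/-! ### Dyadic averages of frequency localized functions -/

/-- The average of `f` over the dyadic interval `[m / 2^j, (m + 1) / 2^j]`. -/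
def dyAvg (f : ℝ → ℂ) (j m : ℕ) : ℂ :=
  2 ^ j * ∫ x in (m / 2 ^ j : ℝ)..((m + 1) / 2 ^ j), f x

lemma norm_dyAvg_le {f : ℝ → ℂ} {a : ℝ} {j m : ℕ}
    (ha : ∀ x ∈ Set.Icc (m / 2 ^ j : ℝ) ((m + 1) / 2 ^ j), ‖f x‖ ≤ a) : ‖dyAvg f j m‖ ≤ a := by
  have hle : (m / 2 ^ j : ℝ) ≤ (m + 1) / 2 ^ j := by gcongr; linarith
  have h := intervalIntegral.norm_integral_le_of_norm_le_const (a := (m / 2 ^ j : ℝ))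
    (b := (m + 1) / 2 ^ j) (f := f) (C := a) fun x hx => ha x (by
      rw [Set.uIoc_of_le hle] at hx
      exact Set.Ioc_subset_Icc_self hx)
  have h2 : |((m + 1) / 2 ^ j : ℝ) - m / 2 ^ j| = 1 / 2 ^ j := by
    rw [← sub_div, add_sub_cancel_left, abs_of_pos (by positivity)]
  rw [h2] at h
  rw [dyAvg, norm_mul, norm_pow, Complex.norm_ofNat]
  calc _ ≤ 2 ^ j * (a * (1 / 2 ^ j)) := by gcongr
    _ = a := by field_simp

lemma dyAvg_sub {f g : ℝ → ℂ} (hf : Continuous f) (hg : Continuous g) (j m : ℕ) :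
    dyAvg (fun x => f x - g x) j m = dyAvg f j m - dyAvg g j m := by
  rw [dyAvg, intervalIntegral.integral_sub (hf.intervalIntegrable _ _) (hg.intervalIntegrable _ _),
    mul_sub]
  rfl

lemma dyAvg_sum {ι : Type*} (s : Finset ι) {f : ι → ℝ → ℂ} (hf : ∀ i, Continuous (f i))
    (j m : ℕ) : dyAvg (fun x => ∑ i ∈ s, f i x) j m = ∑ i ∈ s, dyAvg (f i) j m := by
  simp only [dyAvg]
  rw [intervalIntegral.integral_finsetSum fun i _ => (hf i).intervalIntegrable _ _, Finset.mul_sum]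

lemma dyAvg_const (z : ℂ) (j m : ℕ) : dyAvg (fun _ => z) j m = z := by
  rw [dyAvg, intervalIntegral.integral_const, ← sub_div, add_sub_cancel_left, Complex.real_smul]
  push_cast
  field_simp

/-- The dyadic averages form a martingale on the binary tree. -/
lemma dyAvg_add_dyAvg {f : ℝ → ℂ} (hf : Continuous f) (j m : ℕ) :
    dyAvg f (j + 1) (2 * m) + dyAvg f (j + 1) (2 * m + 1) = 2 * dyAvg f j m := by
  simp only [dyAvg]
  have h1 : (((2 * m : ℕ) : ℝ) / 2 ^ (j + 1)) = m / 2 ^ j := by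
    push_cast
    rw [pow_succ]
    field_simp
  have h2 : (((2 * m + 1 : ℕ) : ℝ) + 1) / 2 ^ (j + 1) = (m + 1) / 2 ^ j := by
    push_cast
    rw [pow_succ]
    field_simp
    ring
  have h3 : (((2 * m : ℕ) : ℝ) + 1) / 2 ^ (j + 1) = ((2 * m + 1 : ℕ) : ℝ) / 2 ^ (j + 1) := by
    push_cast
    ring
  rw [h1, h2, h3, ← mul_add, intervalIntegral.integral_add_adjacent_intervals
    (hf.intervalIntegrable _ _) (hf.intervalIntegrable _ _)]
  ring

lemma dyAvg_odd_eq (f : ℝ → ℂ) (j m : ℕ) :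
    dyAvg f (j + 1) (2 * m + 1) = dyAvg (fun x => f (x + 1 / 2 ^ (j + 1))) (j + 1) (2 * m) := by
  simp only [dyAvg]
  rw [intervalIntegral.integral_comp_add_right]
  congr 2 <;> · push_cast; ring

/-- `TorusBesov.BandLimited k s` says that the frequencies in `s` are those allowed in the `k`-th
Littlewood–Paley piece: `|n| ≤ 2^{k+1}`, and moreover `|n| ≥ 2^{k-1}` if `k ≥ 1`. -/
def BandLimited (k : ℕ) (s : Finset ℤ) : Prop :=
  ∀ n ∈ s, |n| ≤ 2 ^ (k + 1) ∧ (k ≠ 0 → 2 ^ (k - 1) ≤ |n|)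

/-- Averages of a `k`-th Littlewood–Paley piece over intervals longer than `2^{-k}` are small,
since such a piece has an antiderivative of size `2^{-k}`. -/
lemma norm_dyAvg_trigPoly_le {k : ℕ} (hk : k ≠ 0) {s : Finset ℤ} (hs : BandLimited k s)
    {c : ℤ → ℂ} {a : ℝ} (ha : ∀ x, ‖trigPoly s c x‖ ≤ a) (j m : ℕ) :
    ‖dyAvg (trigPoly s c) j m‖ ≤ 16 * Real.pi * a * (2 ^ j / 2 ^ k) := by
  -- The coefficients of the antiderivative; the frequency `0` does not occur as `k ≠ 0`.
  set C : ℤ → ℂ := fun n => c n / (2 * Real.pi * Complex.I * n)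
  have hF : trigPoly s (fun n => 2 * Real.pi * Complex.I * n * C n) = trigPoly s c := by
    funext x
    refine Finset.sum_congr rfl fun n hn => ?_
    have h1 := (hs n hn).2 hk
    have hn0 : n ≠ 0 := by
      rintro rfl
      have : (0 : ℤ) < 2 ^ (k - 1) := by positivity
      rw [abs_zero] at h1
      omega
    have : (2 * Real.pi * Complex.I * n : ℂ) ≠ 0 := by
      simp [Real.pi_ne_zero, hn0, Complex.I_ne_zero]
    simp only [C]
    rw [mul_div_cancel₀ _ this]
  have hbd : ∀ x, ‖trigPoly s C x‖ ≤ 8 * Real.pi * a / 2 ^ k := by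
    intro x
    have h := norm_trigPoly_le_of_norm_deriv_le (n := 2 ^ (k - 1)) (by positivity)
      (fun n hn => by exact_mod_cast (hs n hn).2 hk) C (a := a) (by rw [hF]; exact ha) x
    refine h.trans_eq ?_
    obtain ⟨k, rfl⟩ := Nat.exists_eq_succ_of_ne_zero hk
    rw [Nat.succ_sub_one, Nat.succ_eq_add_one, pow_succ]
    push_cast
    field_simp
    ring
  rw [dyAvg, ← hF, intervalIntegral.integral_eq_sub_of_hasDerivAt
    (fun x _ => hasDerivAt_trigPoly s C x)
    ((continuous_trigPoly _ _).intervalIntegrable _ _), norm_mul, norm_pow, Complex.norm_ofNat]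
  calc _ ≤ 2 ^ j * (8 * Real.pi * a / 2 ^ k + 8 * Real.pi * a / 2 ^ k) := by
        gcongr
        exact (norm_sub_le _ _).trans (add_le_add (hbd _) (hbd _))
    _ = _ := by ring

/-- The geometric weight `2^{-|n|}`. -/
def geomWeight (n : ℤ) : ℝ := (1 / 2) ^ n.natAbs

lemma geomWeight_nonneg (n : ℤ) : 0 ≤ geomWeight n := by
  unfold geomWeight
  positivity

lemma summable_geomWeight : Summable geomWeight := by
  rw [summable_int_iff_summable_nat_and_neg]
  simp only [geomWeight, Int.natAbs_neg, Int.natAbs_natCast, and_self]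
  exact summable_geometric_two

/-- The total mass of the weight `2^{-|n|}`. -/
def geomMass : ℝ := ∑' n, geomWeight n

lemma sum_geomWeight_le {ι : Type*} (s : Finset ι) {g : ι → ℤ} (hg : Function.Injective g) :
    ∑ i ∈ s, geomWeight (g i) ≤ geomMass := by
  refine (Finset.sum_map s ⟨g, hg⟩ geomWeight).symm.trans_le ?_
  exact summable_geomWeight.sum_le_tsum _ fun n _ => geomWeight_nonneg n

lemma one_le_geomMass : 1 ≤ geomMass := by
  have := sum_geomWeight_le {0} (g := fun n : ℤ => n) Function.injective_id
  simpa [geomWeight] using this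

/-- The martingale differences of a `k`-th Littlewood–Paley piece are concentrated at scale
`2^{-k}`: finer differences are controlled by Bernstein's inequality, coarser ones by its
inverse. -/
lemma norm_dyAvg_succ_sub_le {k : ℕ} {s : Finset ℤ} (hs : BandLimited k s)
    {c : ℤ → ℂ} {a : ℝ} (ha : ∀ x, ‖trigPoly s c x‖ ≤ a) (j m : ℕ) :
    ‖dyAvg (trigPoly s c) (j + 1) (2 * m) - dyAvg (trigPoly s c) j m‖
      ≤ 48 * Real.pi * (geomWeight (j - k) * a) := by
  have ha0 : 0 ≤ a := (norm_nonneg _).trans (ha 0)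
  have hpi := Real.pi_pos
  rcases le_or_gt k j with h | h
  · have hw : geomWeight (j - k) = 2 ^ k / 2 ^ j := by
      obtain ⟨i, rfl⟩ := Nat.exists_eq_add_of_le h
      rw [geomWeight, show ((k + i : ℕ) - k : ℤ) = i by push_cast; ring, Int.natAbs_natCast,
        pow_add, one_div, inv_pow]
      field_simp
    have hT := continuous_trigPoly s c
    -- The difference is half the average of `f(x) - f(x + 2^{-j-1})` over the left half interval.
    have h1 : dyAvg (trigPoly s c) (j + 1) (2 * m) - dyAvg (trigPoly s c) j m
        = dyAvg (fun x => trigPoly s c x - trigPoly s c (x + 1 / 2 ^ (j + 1)))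
          (j + 1) (2 * m) / 2 := by
      rw [dyAvg_sub hT (by fun_prop), ← dyAvg_odd_eq]
      linear_combination (1 / 2 : ℂ) * dyAvg_add_dyAvg hT j m
    have hder := norm_deriv_trigPoly_le (n := 2 ^ (k + 1)) (by positivity)
      (fun n hn => by exact_mod_cast (hs n hn).1) c ha
    have hlip : ∀ x, ‖trigPoly s c x - trigPoly s c (x + 1 / 2 ^ (j + 1))‖
        ≤ 4 * Real.pi * (2 ^ (k + 1) : ℕ) * a * (1 / 2 ^ (j + 1)) := by
      intro x
      have := convex_univ.norm_image_sub_le_of_norm_hasDerivWithin_le (𝕜 := ℝ)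
        (f := trigPoly s c) (fun x _ => (hasDerivAt_trigPoly s c x).hasDerivWithinAt)
        (fun x _ => hder x) (Set.mem_univ (x + 1 / 2 ^ (j + 1))) (Set.mem_univ x)
      refine this.trans_eq ?_
      rw [sub_add_cancel_left, norm_neg, Real.norm_of_nonneg (by positivity)]
    rw [h1, norm_div, Complex.norm_ofNat, hw]
    have h2 := norm_dyAvg_le (j := j + 1) (m := 2 * m) fun x _ => hlip x
    have h3 : 4 * Real.pi * (2 ^ (k + 1) : ℕ) * a * (1 / 2 ^ (j + 1))
        = 4 * Real.pi * (2 ^ k / 2 ^ j * a) := by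
      push_cast
      rw [pow_succ, pow_succ]
      field_simp
    have h4 : 0 ≤ Real.pi * (2 ^ k / 2 ^ j * a) := by positivity
    linarith
  · have hw : geomWeight (j - k) = 2 ^ j / 2 ^ k := by
      obtain ⟨i, rfl⟩ := Nat.exists_eq_add_of_le h.le
      rw [geomWeight, show (j - (j + i : ℕ) : ℤ) = -i by push_cast; ring, Int.natAbs_neg,
        Int.natAbs_natCast, pow_add, one_div, inv_pow]
      field_simp
    rw [hw]
    refine (norm_sub_le _ _).trans ((add_le_add
      (norm_dyAvg_trigPoly_le (by omega) hs ha _ _)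
      (norm_dyAvg_trigPoly_le (by omega) hs ha _ _)).trans_eq ?_)
    rw [pow_succ]
    ring

/-! ### Exponential integrability of dyadic martingales -/

lemma cosh_le_exp_rpow {q x b : ℝ} (hq1 : 1 ≤ q) (hq2 : q ≤ 2) (hx : |x| ≤ b) :
    Real.cosh x ≤ Real.exp (b ^ q) := by
  have hb : 0 ≤ b := (abs_nonneg x).trans hx
  rcases le_total b 1 with h | h
  · refine (Real.cosh_le_exp_half_sq x).trans (Real.exp_le_exp.2 ?_)
    have h1 : x ^ 2 ≤ b ^ 2 := sq_le_sq' (abs_le.1 hx).1 (abs_le.1 hx).2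
    have h2 : b ^ (2 : ℝ) ≤ b ^ q := by
      rcases hb.eq_or_lt with rfl | hb
      · rw [Real.zero_rpow (by norm_num), Real.zero_rpow (by linarith)]
      · exact Real.rpow_le_rpow_of_exponent_ge hb h hq2
    rw [Real.rpow_two] at h2
    nlinarith [sq_nonneg x]
  · have h1 : Real.cosh x ≤ Real.exp |x| := by
      rw [← Real.cosh_abs, ← Real.cosh_add_sinh]
      linarith [Real.sinh_nonneg_iff.2 (abs_nonneg x)]
    refine h1.trans (Real.exp_le_exp.2 (hx.trans ?_))
    calc b = b ^ (1 : ℝ) := (Real.rpow_one b).symm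
      _ ≤ b ^ q := Real.rpow_le_rpow_of_exponent_le h hq1

lemma sum_range_two_mul (f : ℕ → ℝ) (n : ℕ) :
    ∑ m ∈ Finset.range (2 * n), f m = ∑ m ∈ Finset.range n, (f (2 * m) + f (2 * m + 1)) := by
  induction n with
  | zero => simp
  | succ n ih =>
    rw [Finset.sum_range_succ, ← ih, show 2 * (n + 1) = 2 * n + 1 + 1 by ring,
      Finset.sum_range_succ, Finset.sum_range_succ, add_assoc]

/-- The Azuma–Hoeffding inequality on the binary tree. The elementary bound
`cosh x ≤ exp |x|^q`, valid for `1 ≤ q ≤ 2`, replaces the usual sum of squares of the increments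
by a sum of `q`-th powers. -/
lemma sum_exp_tree_le {q : ℝ} (hq1 : 1 ≤ q) (hq2 : q ≤ 2) {A : ℕ → ℕ → ℝ} {b : ℕ → ℝ}
    (hA : ∀ j m, A (j + 1) (2 * m) + A (j + 1) (2 * m + 1) = 2 * A j m)
    (hb : ∀ j m, |A (j + 1) (2 * m) - A j m| ≤ b j) (N : ℕ) :
    ∑ m ∈ Finset.range (2 ^ N), Real.exp (A N m)
      ≤ 2 ^ N * Real.exp (A 0 0 + ∑ j ∈ Finset.range N, b j ^ q) := by
  induction N with
  | zero => simp
  | succ N ih =>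
    rw [pow_succ', sum_range_two_mul, Finset.sum_range_succ, ← add_assoc, Real.exp_add]
    have h : ∀ m, Real.exp (A (N + 1) (2 * m)) + Real.exp (A (N + 1) (2 * m + 1))
        ≤ Real.exp (A N m) * (2 * Real.exp (b N ^ q)) := by
      intro m
      set d := A (N + 1) (2 * m) - A N m with hd
      have h1 : A (N + 1) (2 * m) = A N m + d := by rw [hd]; ring
      have h2 : A (N + 1) (2 * m + 1) = A N m + -d := by linarith [hA N m]
      rw [h1, h2, Real.exp_add, Real.exp_add, ← mul_add]
      have h3 := cosh_le_exp_rpow hq1 hq2 (hb N m)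
      rw [← hd, Real.cosh_eq] at h3
      gcongr
      linarith
    calc _ ≤ ∑ m ∈ Finset.range (2 ^ N), Real.exp (A N m) * (2 * Real.exp (b N ^ q)) :=
          Finset.sum_le_sum fun m _ => h m
      _ = (∑ m ∈ Finset.range (2 ^ N), Real.exp (A N m)) * (2 * Real.exp (b N ^ q)) :=
          (Finset.sum_mul _ _ _).symm
      _ ≤ _ := mul_le_mul_of_nonneg_right ih (by positivity)
      _ = _ := by
          rw [pow_succ]
          ring

/-- The exponential of a modulus is dominated by exponentials of four real linear functionals. -/
lemma exp_mul_norm_le {r : ℝ} (hr : 0 ≤ r) (z : ℂ) :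
    Real.exp (r * ‖z‖) ≤ (Real.exp ((2 * r : ℂ) * z).re + Real.exp ((-2 * r : ℂ) * z).re
      + Real.exp ((-2 * r * Complex.I : ℂ) * z).re
      + Real.exp ((2 * r * Complex.I : ℂ) * z).re) / 2 := by
  have e1 : ((2 * r : ℂ) * z).re = 2 * r * z.re := by simp
  have e2 : ((-2 * r : ℂ) * z).re = -(2 * r * z.re) := by simp
  have e3 : ((-2 * r * Complex.I : ℂ) * z).re = 2 * r * z.im := by simp
  have e4 : ((2 * r * Complex.I : ℂ) * z).re = -(2 * r * z.im) := by simp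
  rw [e1, e2, e3, e4]
  have habs : ∀ x : ℝ, Real.exp |x| ≤ Real.exp x + Real.exp (-x) := by
    intro x
    rcases abs_choice x with h | h <;> rw [h] <;> linarith [Real.exp_pos x, Real.exp_pos (-x)]
  have h1 : r * ‖z‖ ≤ r * |z.re| + r * |z.im| := by
    rw [← mul_add]
    exact mul_le_mul_of_nonneg_left (Complex.norm_le_abs_re_add_abs_im z) hr
  have h2 : ∀ x : ℝ, Real.exp (r * |x|) ^ 2 = Real.exp |2 * r * x| := by
    intro x
    rw [← Real.exp_nat_mul, abs_mul, abs_mul, abs_two, abs_of_nonneg hr]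
    push_cast
    ring_nf
  have h3 := (Real.exp_le_exp.2 h1).trans_eq (Real.exp_add _ _)
  have h4 := two_mul_le_add_sq (Real.exp (r * |z.re|)) (Real.exp (r * |z.im|))
  rw [h2, h2] at h4
  linarith [habs (2 * r * z.re), habs (2 * r * z.im)]

/-- The complex valued form of `TorusBesov.sum_exp_tree_le`. -/
lemma sum_exp_norm_tree_le {q : ℝ} (hq1 : 1 ≤ q) (hq2 : q ≤ 2) {A : ℕ → ℕ → ℂ} {b : ℕ → ℝ}
    (hA : ∀ j m, A (j + 1) (2 * m) + A (j + 1) (2 * m + 1) = 2 * A j m)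
    (hb : ∀ j m, ‖A (j + 1) (2 * m) - A j m‖ ≤ b j) {r : ℝ} (hr : 0 ≤ r) (N : ℕ) :
    ∑ m ∈ Finset.range (2 ^ N), Real.exp (r * ‖A N m‖)
      ≤ 2 ^ N * (2 * Real.exp (2 * r * ‖A 0 0‖ + ∑ j ∈ Finset.range N, (2 * r * b j) ^ q)) := by
  have key : ∀ w : ℂ, ‖w‖ = 2 * r → ∑ m ∈ Finset.range (2 ^ N), Real.exp (w * A N m).re
      ≤ 2 ^ N * Real.exp (2 * r * ‖A 0 0‖ + ∑ j ∈ Finset.range N, (2 * r * b j) ^ q) := by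
    intro w hw
    refine (sum_exp_tree_le hq1 hq2 (A := fun j m => (w * A j m).re) (b := fun j => 2 * r * b j)
      (fun j m => ?_) (fun j m => ?_) N).trans ?_
    · rw [← Complex.add_re, ← mul_add, hA, show w * (2 * A j m) = (2 : ℝ) * (w * A j m) by
        push_cast; ring, Complex.re_ofReal_mul]
    · rw [← Complex.sub_re, ← mul_sub]
      refine (Complex.abs_re_le_norm _).trans ?_
      rw [norm_mul, hw]
      exact mul_le_mul_of_nonneg_left (hb j m) (by positivity)
    · gcongr
      refine (Complex.re_le_norm _).trans_eq ?_
      rw [norm_mul, hw]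
  have hr' : ‖(r : ℂ)‖ = r := by rw [Complex.norm_real, Real.norm_of_nonneg hr]
  have k1 := key (2 * r) (by simp [hr])
  have k2 := key (-2 * r) (by simp [hr])
  have k3 := key (-2 * r * Complex.I) (by simp [hr])
  have k4 := key (2 * r * Complex.I) (by simp [hr])
  have h := Finset.sum_le_sum fun m (_ : m ∈ Finset.range (2 ^ N)) =>
    exp_mul_norm_le hr (A N m)
  rw [← Finset.sum_div, Finset.sum_add_distrib, Finset.sum_add_distrib,
    Finset.sum_add_distrib] at h
  linarith

/-- Exponential integrability of a continuous function on `[0, 1]` in terms of the differences of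
its dyadic averages. -/
lemma integral_exp_norm_le {q : ℝ} (hq1 : 1 ≤ q) (hq2 : q ≤ 2) {f : ℝ → ℂ} (hf : Continuous f)
    {b : ℕ → ℝ} (hb : ∀ j m, ‖dyAvg f (j + 1) (2 * m) - dyAvg f j m‖ ≤ b j) {r : ℝ} (hr : 0 ≤ r)
    {S : ℝ} (hS : ∀ N, ∑ j ∈ Finset.range N, (2 * r * b j) ^ q ≤ S) :
    ∫ x in (0 : ℝ)..1, Real.exp (r * ‖f x‖)
      ≤ 2 * Real.exp (1 + 2 * r * ‖dyAvg f 0 0‖ + S) := by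
  have huc := (isCompact_Icc (a := (0 : ℝ)) (b := 1)).uniformContinuousOn_of_continuous
    hf.continuousOn
  rw [Metric.uniformContinuousOn_iff_le] at huc
  obtain ⟨δ, hδ, huc⟩ := huc (1 / (r + 1)) (by positivity)
  -- At this scale `f` differs from its averages by at most `1 / (r + 1)`, which costs a factor `e`.
  obtain ⟨N, hN⟩ := exists_pow_lt_of_lt_one hδ (show (1 / 2 : ℝ) < 1 by norm_num)
  have hI : ∀ m : ℕ, m < 2 ^ N → ∀ x ∈ Set.Icc (m / 2 ^ N : ℝ) ((m + 1) / 2 ^ N),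
      Real.exp (r * ‖f x‖) ≤ Real.exp 1 * Real.exp (r * ‖dyAvg f N m‖) := by
    intro m hm x hx
    have hsub : Set.Icc (m / 2 ^ N : ℝ) ((m + 1) / 2 ^ N) ⊆ Set.Icc 0 1 := by
      refine Set.Icc_subset_Icc (by positivity) ?_
      rw [div_le_one (by positivity)]
      exact_mod_cast Nat.succ_le_of_lt hm
    have h1 : ∀ y ∈ Set.Icc (m / 2 ^ N : ℝ) ((m + 1) / 2 ^ N), ‖f x - f y‖ ≤ 1 / (r + 1) := by
      intro y hy
      rw [← dist_eq_norm]
      refine huc x (hsub hx) y (hsub hy) ?_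
      refine (Real.dist_le_of_mem_Icc hx hy).trans ?_
      rw [← sub_div, add_sub_cancel_left]
      rw [one_div, inv_pow] at hN
      rw [one_div]
      exact hN.le
    have h2 : ‖f x - dyAvg f N m‖ ≤ 1 / (r + 1) := by
      have := norm_dyAvg_le h1
      rwa [dyAvg_sub continuous_const hf, dyAvg_const] at this
    have h3 : ‖f x‖ ≤ 1 / (r + 1) + ‖dyAvg f N m‖ := by
      linarith [norm_sub_norm_le (f x) (dyAvg f N m)]
    have h4 : r * (1 / (r + 1)) ≤ 1 := by
      rw [mul_one_div, div_le_one (by positivity)]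
      linarith
    rw [← Real.exp_add]
    refine Real.exp_le_exp.2 ?_
    nlinarith [mul_le_mul_of_nonneg_left h3 hr]
  have hcont : Continuous fun x => Real.exp (r * ‖f x‖) := by fun_prop
  have hsplit := intervalIntegral.sum_integral_adjacent_intervals (n := 2 ^ N)
    (a := fun m : ℕ => (m / 2 ^ N : ℝ)) (f := fun x => Real.exp (r * ‖f x‖)) (μ := volume)
    fun m _ => hcont.intervalIntegrable _ _
  have hone : ((2 ^ N : ℕ) : ℝ) / 2 ^ N = 1 := by
    push_cast
    exact div_self (by positivity)
  simp only [Nat.cast_zero, zero_div, hone, Nat.cast_add, Nat.cast_one] at hsplit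
  rw [← hsplit]
  have hterm : ∀ m ∈ Finset.range (2 ^ N),
      ∫ x in (m / 2 ^ N : ℝ)..((m + 1) / 2 ^ N), Real.exp (r * ‖f x‖)
        ≤ 1 / 2 ^ N * Real.exp 1 * Real.exp (r * ‖dyAvg f N m‖) := by
    intro m hm
    have hle : (m / 2 ^ N : ℝ) ≤ (m + 1) / 2 ^ N := by gcongr; linarith
    refine (intervalIntegral.integral_mono_on hle (hcont.intervalIntegrable _ _)
      (intervalIntegrable_const (c := Real.exp 1 * Real.exp (r * ‖dyAvg f N m‖)))
      (hI m (Finset.mem_range.1 hm))).trans_eq ?_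
    rw [intervalIntegral.integral_const, ← sub_div, add_sub_cancel_left, smul_eq_mul]
    ring
  refine (Finset.sum_le_sum hterm).trans ?_
  rw [← Finset.mul_sum]
  have htree := sum_exp_norm_tree_le hq1 hq2 (dyAvg_add_dyAvg hf) hb hr N
  calc _ ≤ 1 / 2 ^ N * Real.exp 1 * (2 ^ N * (2 * Real.exp (2 * r * ‖dyAvg f 0 0‖ + S))) := by
        gcongr
        exact htree.trans (by gcongr; exact hS N)
    _ = _ := by
        rw [add_assoc, Real.exp_add 1]
        field_simp

/-! ### The `L^p` estimate for finite sums of Littlewood–Paley pieces -/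

lemma rpow_sum_geomWeight_mul_le {q : ℝ} (hq : 1 ≤ q) (s : Finset ℕ) {a : ℕ → ℝ}
    (ha : ∀ k, 0 ≤ a k) (j : ℕ) :
    (∑ k ∈ s, geomWeight (j - k) * a k) ^ q
      ≤ geomMass ^ (q - 1) * ∑ k ∈ s, geomWeight (j - k) * a k ^ q := by
  have hq0 : 0 < q := by linarith
  have h := Real.inner_le_weight_mul_Lp_of_nonneg s hq (fun k : ℕ => geomWeight (j - k)) a
    (fun k => geomWeight_nonneg _) ha
  have hW : ∑ k ∈ s, geomWeight (j - k) ≤ geomMass :=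
    sum_geomWeight_le s (g := fun k : ℕ => (j - k : ℤ)) fun k l hkl => by
      simp only [sub_right_inj, Nat.cast_inj] at hkl
      exact hkl
  have hW0 : 0 ≤ ∑ k ∈ s, geomWeight (j - k) := Finset.sum_nonneg fun k _ => geomWeight_nonneg _
  have hS0 : 0 ≤ ∑ k ∈ s, geomWeight (j - k) * a k ^ q :=
    Finset.sum_nonneg fun k _ => mul_nonneg (geomWeight_nonneg _) (Real.rpow_nonneg (ha k) _)
  have hL0 : 0 ≤ ∑ k ∈ s, geomWeight (j - k) * a k :=
    Finset.sum_nonneg fun k _ => mul_nonneg (geomWeight_nonneg _) (ha k)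
  refine (Real.rpow_le_rpow hL0 h hq0.le).trans ?_
  rw [Real.mul_rpow (Real.rpow_nonneg hW0 _) (Real.rpow_nonneg hS0 _), ← Real.rpow_mul hW0,
    ← Real.rpow_mul hS0, inv_mul_cancel₀ hq0.ne', Real.rpow_one, sub_mul, one_mul,
    inv_mul_cancel₀ hq0.ne']
  have : 0 ≤ q - 1 := by linarith
  gcongr

/-- Young's inequality in `ℓ^q` for the convolution with the weight `2^{-|n|}`. -/
lemma sum_rpow_sum_geomWeight_mul_le {q : ℝ} (hq : 1 ≤ q) (s t : Finset ℕ) {a : ℕ → ℝ}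
    (ha : ∀ k, 0 ≤ a k) :
    ∑ j ∈ t, (∑ k ∈ s, geomWeight (j - k) * a k) ^ q ≤ geomMass ^ q * ∑ k ∈ s, a k ^ q := by
  have hM : 0 < geomMass := by linarith [one_le_geomMass]
  refine (Finset.sum_le_sum fun j _ => rpow_sum_geomWeight_mul_le hq s ha j).trans ?_
  rw [← Finset.mul_sum, Finset.sum_comm]
  have h : ∀ k ∈ s, ∑ j ∈ t, geomWeight (j - k) * a k ^ q ≤ geomMass * a k ^ q := by
    intro k _
    rw [← Finset.sum_mul]
    refine mul_le_mul_of_nonneg_right ?_ (Real.rpow_nonneg (ha k) _)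
    exact sum_geomWeight_le t (g := fun j : ℕ => (j - k : ℤ)) fun i l hil => by
      simp only [sub_left_inj, Nat.cast_inj] at hil
      exact hil
  calc _ ≤ geomMass ^ (q - 1) * ∑ k ∈ s, geomMass * a k ^ q := by
        gcongr with k hk
        exact h k hk
    _ = _ := by
        rw [← Finset.mul_sum, ← mul_assoc, ← Real.rpow_add_one hM.ne', sub_add_cancel]

/-- The constant in the `L^p` estimates; it depends neither on `p` and `q` nor on the cut-off. -/
def embConst : ℝ :=
  2 * Real.exp (1 + 32 * Real.pi * geomMass + (96 * Real.pi * geomMass) ^ 2)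

lemma embConst_pos : 0 < embConst := by
  unfold embConst
  positivity

/-- The elementary inequality `t^p ≤ (p / r)^p e^{rt}`, by which exponential moments control power
moments. -/
lemma rpow_le_mul_exp {p r t : ℝ} (hp : 0 < p) (hr : 0 < r) (ht : 0 ≤ t) :
    t ^ p ≤ (p / r) ^ p * Real.exp (r * t) := by
  have h1 : t ≤ p / r * Real.exp (r * t / p) := by
    have h := Real.add_one_le_exp (r * t / p)
    have h2 : t = p / r * (r * t / p) := by field_simp
    calc t = p / r * (r * t / p) := h2
      _ ≤ _ := by
        gcongr
        linarith
  refine (Real.rpow_le_rpow ht h1 hp.le).trans_eq ?_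
  rw [Real.mul_rpow (by positivity) (Real.exp_pos _).le, ← Real.exp_mul, div_mul_cancel₀ _ hp.ne']

/-- The mean over `[0, 1]` of a `k`-th Littlewood–Paley piece. For `k ≥ 1` it is in fact zero, but
the geometric decay, which the general bound for averages provides, suffices. -/
lemma norm_dyAvg_zero_le {k : ℕ} {s : Finset ℤ} (hs : BandLimited k s)
    {c : ℤ → ℂ} {a : ℝ} (ha : ∀ x, ‖trigPoly s c x‖ ≤ a) :
    ‖dyAvg (trigPoly s c) 0 0‖ ≤ 16 * Real.pi * (geomWeight (0 - k) * a) := by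
  have ha0 : 0 ≤ a := (norm_nonneg _).trans (ha 0)
  rcases eq_or_ne k 0 with rfl | hk
  · refine (norm_dyAvg_le fun x _ => ha x).trans ?_
    simp only [geomWeight]
    norm_num
    nlinarith [Real.pi_gt_three]
  · refine (norm_dyAvg_trigPoly_le hk hs ha 0 0).trans_eq ?_
    simp [geomWeight]
    ring

/-- The `L^p` norm of a finite sum of Littlewood–Paley pieces is controlled by the `ℓ^q` norm of
their suprema, with a constant of order `p^{1/q'}`. The parameter of the exponential moment is
`r = p^{1/q} / α`. -/
lemma integral_norm_sum_rpow_le {q : ℝ} (hq1 : 1 ≤ q) (hq2 : q ≤ 2) {p : ℝ} (hp : 1 ≤ p)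
    (s : Finset ℕ) {S : ℕ → Finset ℤ} (hS : ∀ k, BandLimited k (S k)) (c : ℕ → ℤ → ℂ)
    {a : ℕ → ℝ} (ha : ∀ k x, ‖trigPoly (S k) (c k) x‖ ≤ a k) {α : ℝ} (hα : 0 < α)
    (hsum : ∑ k ∈ s, a k ^ q ≤ α ^ q) :
    ∫ x in (0 : ℝ)..1, ‖∑ k ∈ s, trigPoly (S k) (c k) x‖ ^ p
      ≤ (embConst * p ^ (1 - 1 / q) * α) ^ p := by
  have hp0 : 0 < p := by linarith
  have hq0 : 0 < q := by linarith
  have hpi := Real.pi_pos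
  have hW := one_le_geomMass
  have ha0 : ∀ k, 0 ≤ a k := fun k => (norm_nonneg _).trans (ha k 0)
  set f : ℝ → ℂ := fun x => ∑ k ∈ s, trigPoly (S k) (c k) x with hf
  have hfc : Continuous f := by fun_prop
  have hdiff : ∀ j m, ‖dyAvg f (j + 1) (2 * m) - dyAvg f j m‖
      ≤ 48 * Real.pi * ∑ k ∈ s, geomWeight (j - k) * a k := by
    intro j m
    rw [hf, dyAvg_sum s (fun k => continuous_trigPoly (S k) (c k)),
      dyAvg_sum s (fun k => continuous_trigPoly (S k) (c k)), ← Finset.sum_sub_distrib,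
      Finset.mul_sum]
    exact (norm_sum_le _ _).trans
      (Finset.sum_le_sum fun k _ => norm_dyAvg_succ_sub_le (hS k) (ha k) j m)
  have haα : ∀ k ∈ s, a k ≤ α := by
    intro k hk
    rw [← Real.rpow_le_rpow_iff (ha0 k) hα.le hq0]
    exact (Finset.single_le_sum (f := fun k => a k ^ q)
      (fun k _ => Real.rpow_nonneg (ha0 k) _) hk).trans hsum
  have hmean : ‖dyAvg f 0 0‖ ≤ 16 * Real.pi * (geomMass * α) := by
    rw [hf, dyAvg_sum s (fun k => continuous_trigPoly (S k) (c k))]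
    refine (norm_sum_le _ _).trans ((Finset.sum_le_sum fun k _ =>
      norm_dyAvg_zero_le (hS k) (ha k)).trans ?_)
    rw [← Finset.mul_sum]
    gcongr
    calc _ ≤ ∑ k ∈ s, geomWeight (0 - k) * α := by
          gcongr with k hk
          · exact geomWeight_nonneg _
          · exact haα k hk
      _ ≤ _ := by
          rw [← Finset.sum_mul]
          gcongr
          exact sum_geomWeight_le s (g := fun k : ℕ => (0 - k : ℤ)) fun k l hkl => by
            simp only [sub_right_inj, Nat.cast_inj] at hkl
            exact hkl
  set r : ℝ := p ^ (1 / q) / α with hr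
  have hr0 : 0 < r := by positivity
  have hrα : (r * α) ^ q = p := by
    rw [hr, div_mul_cancel₀ _ hα.ne', ← Real.rpow_mul hp0.le, one_div_mul_cancel hq0.ne',
      Real.rpow_one]
  have hrp : r * α ≤ p := by
    rw [hr, div_mul_cancel₀ _ hα.ne']
    calc p ^ (1 / q) ≤ p ^ (1 : ℝ) :=
          Real.rpow_le_rpow_of_exponent_le hp (by rw [div_le_one hq0]; exact hq1)
      _ = p := Real.rpow_one p
  have hpr : p / r = p ^ (1 - 1 / q) * α := by
    rw [hr, Real.rpow_sub hp0, Real.rpow_one]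
    field_simp
  have hincr : ∀ N, ∑ j ∈ Finset.range N,
      (2 * r * (48 * Real.pi * ∑ k ∈ s, geomWeight (j - k) * a k)) ^ q
        ≤ (96 * Real.pi * geomMass) ^ 2 * p := by
    intro N
    have hL0 : ∀ j : ℕ, 0 ≤ ∑ k ∈ s, geomWeight (j - k) * a k := fun j =>
      Finset.sum_nonneg fun k _ => mul_nonneg (geomWeight_nonneg _) (ha0 k)
    have h1 : ∀ j : ℕ, (2 * r * (48 * Real.pi * ∑ k ∈ s, geomWeight (j - k) * a k)) ^ q
        = (96 * Real.pi * r) ^ q * (∑ k ∈ s, geomWeight (j - k) * a k) ^ q := by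
      intro j
      rw [← Real.mul_rpow (by positivity) (hL0 j)]
      ring_nf
    simp_rw [h1]
    rw [← Finset.mul_sum]
    have h2 : 1 ≤ 96 * Real.pi * geomMass := by nlinarith [Real.pi_gt_three]
    calc _ ≤ (96 * Real.pi * r) ^ q * (geomMass ^ q * α ^ q) := by
          gcongr
          exact (sum_rpow_sum_geomWeight_mul_le hq1 s _ ha0).trans (by gcongr)
      _ = (96 * Real.pi * geomMass) ^ q * p := by
          rw [← hrα, ← Real.mul_rpow (by positivity) hα.le,
            ← Real.mul_rpow (by positivity) (by positivity),
            ← Real.mul_rpow (by positivity) (by positivity)]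
          ring_nf
      _ ≤ (96 * Real.pi * geomMass) ^ 2 * p := by
          rw [← Real.rpow_two]
          gcongr
  have hexp := integral_exp_norm_le hq1 hq2 hfc hdiff hr0.le hincr
  have hexp2 : 2 * Real.exp (1 + 2 * r * ‖dyAvg f 0 0‖ + (96 * Real.pi * geomMass) ^ 2 * p)
      ≤ embConst ^ p := by
    rw [embConst, Real.mul_rpow (by norm_num) (Real.exp_pos _).le, ← Real.exp_mul]
    have h2 : (2 : ℝ) ≤ 2 ^ p := by
      calc (2 : ℝ) = 2 ^ (1 : ℝ) := (Real.rpow_one _).symm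
        _ ≤ _ := Real.rpow_le_rpow_of_exponent_le (by norm_num) hp
    gcongr
    have h3 : 2 * r * ‖dyAvg f 0 0‖ ≤ 32 * Real.pi * geomMass * p := by
      calc _ ≤ 2 * r * (16 * Real.pi * (geomMass * α)) := by gcongr
        _ = 32 * Real.pi * geomMass * (r * α) := by ring
        _ ≤ _ := by gcongr
    linarith
  calc _ ≤ ∫ x in (0 : ℝ)..1, (p / r) ^ p * Real.exp (r * ‖f x‖) := by
        refine intervalIntegral.integral_mono_on (by norm_num)
          (Continuous.intervalIntegrable ?_ _ _) (Continuous.intervalIntegrable ?_ _ _)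
          fun x _ => rpow_le_mul_exp hp0 hr0 (norm_nonneg _)
        · exact hfc.norm.rpow_const fun x => Or.inr hp0.le
        · fun_prop
    _ ≤ (p / r) ^ p * embConst ^ p := by
        rw [intervalIntegral.integral_const_mul]
        gcongr
        exact hexp.trans hexp2
    _ = _ := by
        rw [hpr, ← Real.mul_rpow (by positivity) embConst_pos.le]
        ring_nf

lemma haarAddCircle_eq_volume : (haarAddCircle : Measure UnitAddCircle) = volume := by
  rw [volume_eq_smul_haarAddCircle]
  simp

lemma eLpNorm_haarAddCircle_le {g : UnitAddCircle → ℂ} (hg : Continuous g) {p B : ℝ} (hp : 0 < p)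
    (hB : 0 ≤ B) (h : ∫ x in (0 : ℝ)..1, ‖g (x : UnitAddCircle)‖ ^ p ≤ B ^ p) :
    eLpNorm g (ENNReal.ofReal p) haarAddCircle ≤ ENNReal.ofReal B := by
  have hp' : ENNReal.ofReal p ≠ 0 := by simpa using hp
  rw [eLpNorm_eq_lintegral_rpow_enorm_toReal hp' ENNReal.ofReal_ne_top,
    ENNReal.toReal_ofReal hp.le, haarAddCircle_eq_volume,
    ← UnitAddCircle.lintegral_preimage 0, zero_add]
  have hc : Continuous fun x : ℝ => ‖g (x : UnitAddCircle)‖ ^ p :=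
    (hg.comp (AddCircle.continuous_mk' 1)).norm.rpow_const fun _ => Or.inr hp.le
  have h1 : ∫⁻ x in Set.Ioc (0 : ℝ) 1, ‖g (x : UnitAddCircle)‖ₑ ^ p ≤ ENNReal.ofReal (B ^ p) := by
    have h2 : ∀ x : ℝ, ‖g (x : UnitAddCircle)‖ₑ ^ p
        = ENNReal.ofReal (‖g (x : UnitAddCircle)‖ ^ p) := fun x => by
      rw [← ofReal_norm, ENNReal.ofReal_rpow_of_nonneg (norm_nonneg _) hp.le]
    simp_rw [h2]
    rw [← ofReal_integral_eq_lintegral_ofReal]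
    · rw [← intervalIntegral.integral_of_le zero_le_one]
      exact ENNReal.ofReal_le_ofReal h
    · exact (hc.intervalIntegrable 0 1).1
    · exact Filter.Eventually.of_forall fun x => by positivity
  calc _ ≤ (ENNReal.ofReal (B ^ p)) ^ (1 / p) := by gcongr
    _ = ENNReal.ofReal B := by
      rw [← ENNReal.ofReal_rpow_of_nonneg hB hp.le, ← ENNReal.rpow_mul, mul_one_div_cancel hp.ne',
        ENNReal.rpow_one]

/-! ### Distributions are determined by their Fourier coefficients -/

lemma contDiff_lift (φ : SmoothFun) :
    ContDiff ℝ ∞ fun x : ℝ => (φ : UnitAddCircle → ℂ) (x : UnitAddCircle) := φ.2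

lemma continuous_smoothFun (φ : SmoothFun) : Continuous (φ : UnitAddCircle → ℂ) :=
  continuous_coinduced_dom.2 (contDiff_lift φ).continuous

/-- A smooth function on `𝕋` as a bundled continuous function. -/
def toContinuousMap (φ : SmoothFun) : C(UnitAddCircle, ℂ) where
  toFun := (φ : UnitAddCircle → ℂ)
  continuous_toFun := continuous_smoothFun φ

lemma coe_toContinuousMap (φ : SmoothFun) :
    (toContinuousMap φ : UnitAddCircle → ℂ) = (φ : UnitAddCircle → ℂ) := rfl

lemma periodic_deriv_lift (φ : SmoothFun) :
    Function.Periodic (deriv fun y : ℝ => (φ : UnitAddCircle → ℂ) (y : UnitAddCircle)) (1 : ℝ) := by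
  intro x
  rw [← deriv_comp_add_const]
  simp

/-- Differentiation on `C^∞(𝕋)`. -/
def smoothDeriv : SmoothFun →ₗ[ℂ] SmoothFun where
  toFun φ := ⟨(periodic_deriv_lift φ).lift, by
    change ContDiff ℝ ∞ fun x : ℝ => (periodic_deriv_lift φ).lift (x : UnitAddCircle)
    simp only [Function.Periodic.lift_coe]
    exact ContDiff.deriv' (n := ∞) (contDiff_lift φ)⟩
  map_add' φ ψ := by
    ext x
    induction x using QuotientAddGroup.induction_on with
    | H x =>
      change deriv (fun y : ℝ => (φ : UnitAddCircle → ℂ) y + (ψ : UnitAddCircle → ℂ) y) x = _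
      exact deriv_fun_add ((contDiff_lift φ).differentiable (by simp) x)
        ((contDiff_lift ψ).differentiable (by simp) x)
  map_smul' c φ := by
    ext x
    induction x using QuotientAddGroup.induction_on with
    | H x =>
      change deriv (fun y : ℝ => c • (φ : UnitAddCircle → ℂ) y) x = _
      exact deriv_fun_const_smul c ((contDiff_lift φ).differentiable (by simp) x)

lemma smoothDeriv_coe (φ : SmoothFun) (x : ℝ) :
    (smoothDeriv φ : UnitAddCircle → ℂ) (x : UnitAddCircle)
      = deriv (fun y : ℝ => (φ : UnitAddCircle → ℂ) (y : UnitAddCircle)) x := rfl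

lemma iteratedDeriv_eq_smoothDeriv_iterate (φ : SmoothFun) (j : ℕ) :
    iteratedDeriv j (fun y : ℝ => (φ : UnitAddCircle → ℂ) (y : UnitAddCircle))
      = fun y : ℝ => ((smoothDeriv^[j] φ : SmoothFun) : UnitAddCircle → ℂ) (y : UnitAddCircle) := by
  induction j with
  | zero => simp
  | succ j ih =>
    rw [iteratedDeriv_succ, ih, Function.iterate_succ_apply']
    rfl

lemma expFun_apply (n : ℤ) (x : UnitAddCircle) : (expFun n : UnitAddCircle → ℂ) x = fourier n x :=
  rfl

lemma smoothDeriv_expFun (n : ℤ) :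
    smoothDeriv (expFun n) = (2 * Real.pi * Complex.I * n : ℂ) • expFun n := by
  ext x
  induction x using QuotientAddGroup.induction_on with
  | H x =>
    change deriv (fun y : ℝ => fourier n (y : UnitAddCircle)) x
      = (2 * Real.pi * Complex.I * n : ℂ) * fourier n (x : UnitAddCircle)
    simp only [fourier_eq_expo]
    exact (hasDerivAt_expo n x).deriv

lemma fourierCoeff_smoothDeriv (φ : SmoothFun) (n : ℤ) :
    fourierCoeff (smoothDeriv φ : UnitAddCircle → ℂ) n
      = 2 * Real.pi * Complex.I * n * fourierCoeff (φ : UnitAddCircle → ℂ) n := by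
  rw [fourierCoeff_eq_intervalIntegral _ n 0, fourierCoeff_eq_intervalIntegral _ n 0]
  simp only [smul_eq_mul, fourier_eq_expo, smoothDeriv_coe, zero_add, div_one, one_smul]
  have hd : ∀ x : ℝ, HasDerivAt (fun y : ℝ => (φ : UnitAddCircle → ℂ) (y : UnitAddCircle))
      (deriv (fun y : ℝ => (φ : UnitAddCircle → ℂ) (y : UnitAddCircle)) x) x := fun x =>
    ((contDiff_lift φ).differentiable (by simp) x).hasDerivAt
  rw [intervalIntegral.integral_mul_deriv_eq_deriv_mul
    (fun x _ => hasDerivAt_expo (-n) x) (fun x _ => hd x)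
    (Continuous.intervalIntegrable (by fun_prop) _ _)
    (((contDiff_lift φ).continuous_deriv (by simp)).intervalIntegrable _ _)]
  have h1 : ((1 : ℝ) : UnitAddCircle) = ((0 : ℝ) : UnitAddCircle) := by
    simp [AddCircle.coe_period]
  have h2 : expo (-n) 1 = expo (-n) 0 := by
    rw [← fourier_eq_expo, ← fourier_eq_expo, h1]
  rw [h1, h2, sub_self, zero_sub, ← intervalIntegral.integral_neg,
    ← intervalIntegral.integral_const_mul]
  refine intervalIntegral.integral_congr fun x _ => ?_
  push_cast
  ring

lemma norm_fourierCoeff_le (f : UnitAddCircle → ℂ) (n : ℤ) :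
    ‖fourierCoeff f n‖ ≤ ∫ x, ‖f x‖ ∂haarAddCircle := by
  refine (norm_integral_le_integral_norm _).trans_eq ?_
  congr 1
  funext x
  rw [norm_smul, fourier_apply, Circle.norm_coe, one_mul]

lemma summable_fourierCoeff (φ : SmoothFun) :
    Summable (fourierCoeff (φ : UnitAddCircle → ℂ)) := by
  set M := ∫ x, ‖(smoothDeriv (smoothDeriv φ) : UnitAddCircle → ℂ) x‖ ∂haarAddCircle
  refine Summable.of_norm_bounded_eventually
    ((Real.summable_one_div_int_pow.2 one_lt_two).mul_left M) ?_
  -- The coefficient at `0` has to be left out, where `1 / n ^ 2` is `0`.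
  filter_upwards [(Set.finite_singleton (0 : ℤ)).compl_mem_cofinite] with n hn
  have hn0 : (n : ℝ) ≠ 0 := by exact_mod_cast hn
  have h := norm_fourierCoeff_le (smoothDeriv (smoothDeriv φ)) n
  rw [fourierCoeff_smoothDeriv, fourierCoeff_smoothDeriv] at h
  simp only [norm_mul, Complex.norm_ofNat, Complex.norm_real, Complex.norm_I,
    Complex.norm_intCast, Real.norm_eq_abs, abs_of_pos Real.pi_pos, mul_one] at h
  rw [mul_one_div, le_div_iff₀ (by positivity), ← sq_abs]
  refine le_trans ?_ h
  have h1 : 1 ≤ (2 * Real.pi) ^ 2 := by nlinarith [Real.pi_gt_three]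
  have h2 : 0 ≤ ‖fourierCoeff (φ : UnitAddCircle → ℂ) n‖ * |(n : ℝ)| ^ 2 := by positivity
  nlinarith

/-- The partial sum over `s` of the Fourier series of a smooth function. -/
def fourierPartialSum (s : Finset ℤ) (φ : SmoothFun) : SmoothFun :=
  ∑ n ∈ s, fourierCoeff (φ : UnitAddCircle → ℂ) n • expFun n

lemma smoothDeriv_iterate_sub_fourierPartialSum (s : Finset ℤ) (φ : SmoothFun) (j : ℕ) :
    smoothDeriv^[j] (φ - fourierPartialSum s φ)
      = smoothDeriv^[j] φ - fourierPartialSum s (smoothDeriv^[j] φ) := by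
  induction j with
  | zero => rfl
  | succ j ih =>
    rw [Function.iterate_succ_apply', ih, Function.iterate_succ_apply', map_sub]
    congr 1
    rw [fourierPartialSum, map_sum]
    refine Finset.sum_congr rfl fun n _ => ?_
    rw [map_smul, smoothDeriv_expFun, smul_smul, fourierCoeff_smoothDeriv, mul_comm]

lemma eventually_norm_sub_fourierPartialSum_le (φ : SmoothFun) {ε : ℝ} (hε : 0 < ε) :
    ∀ᶠ s in Filter.atTop, ∀ x, ‖((φ - fourierPartialSum s φ : SmoothFun) :
      UnitAddCircle → ℂ) x‖ ≤ ε := by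
  have h := hasSum_fourier_series_of_summable (f := toContinuousMap φ)
    (summable_fourierCoeff φ)
  filter_upwards [Metric.tendsto_nhds.1 h ε hε] with s hs x
  rw [dist_comm, dist_eq_norm] at hs
  refine le_trans (le_of_eq ?_) ((ContinuousMap.norm_coe_le_norm _ x).trans hs.le)
  congr 1
  simp [fourierPartialSum, ContinuousMap.sum_apply, expFun_apply, coe_toContinuousMap]

/-- The Fourier series of a smooth function converges in `C^∞(𝕋)`, so that a distribution may be
evaluated termwise. -/
lemma hasSum_fourierCoeff_mul_coeff (u : Distribution) (φ : SmoothFun) :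
    HasSum (fun n => fourierCoeff (φ : UnitAddCircle → ℂ) n * coeff u (-n)) (u.1 φ) := by
  obtain ⟨N, C, hu⟩ := u.2
  have hsum : ∀ s, ∑ n ∈ s, fourierCoeff (φ : UnitAddCircle → ℂ) n * coeff u (-n)
      = u.1 (fourierPartialSum s φ) := by
    intro s
    rw [fourierPartialSum, map_sum]
    refine Finset.sum_congr rfl fun n _ => ?_
    rw [map_smul, coeff, neg_neg, smul_eq_mul]
  rw [HasSum, SummationFilter.unconditional_filter]
  simp_rw [hsum]
  rw [Metric.tendsto_nhds]
  intro ε hε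
  have hδ : 0 < ε / (|C| + 1) := by positivity
  have hall : ∀ᶠ s in Filter.atTop, ∀ j ∈ Finset.range (N + 1), ∀ x,
      ‖((smoothDeriv^[j] φ - fourierPartialSum s (smoothDeriv^[j] φ) : SmoothFun) :
        UnitAddCircle → ℂ) x‖ ≤ ε / (|C| + 1) :=
    (Filter.eventually_all_finset _).2 fun j _ => eventually_norm_sub_fourierPartialSum_le _ hδ
  filter_upwards [hall] with s hs
  have h := hu (φ - fourierPartialSum s φ) (ε / (|C| + 1)) fun j hj x => by
    rw [iteratedDeriv_eq_smoothDeriv_iterate, smoothDeriv_iterate_sub_fourierPartialSum]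
    exact hs j (Finset.mem_range.2 (by omega)) _
  rw [dist_comm, dist_eq_norm, ← map_sub]
  refine h.trans_lt ?_
  rw [mul_div_assoc', div_lt_iff₀ (by positivity)]
  nlinarith [le_abs_self C]

lemma distribution_ext_coeff {u v : Distribution} (h : ∀ n, coeff u n = coeff v n) : u = v := by
  refine Subtype.ext (LinearMap.ext fun φ => ?_)
  have h1 := hasSum_fourierCoeff_mul_coeff u φ
  simp_rw [h] at h1
  exact h1.unique (hasSum_fourierCoeff_mul_coeff v φ)

lemma integrable_mul_smoothFun {f : UnitAddCircle → ℂ} (hf : Integrable f haarAddCircle)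
    (φ : SmoothFun) : Integrable (fun x => f x * (φ : UnitAddCircle → ℂ) x) haarAddCircle :=
  hf.mul_bdd (c := ‖toContinuousMap φ‖) (continuous_smoothFun φ).aestronglyMeasurable
    (Filter.Eventually.of_forall fun x => (toContinuousMap φ).norm_coe_le_norm x)

/-- The distribution `φ ↦ ∫ f φ` given by an integrable function `f`. -/
def distOfIntegrable (f : UnitAddCircle → ℂ) (hf : Integrable f haarAddCircle) :
    Distribution :=
  ⟨{ toFun := fun φ => ∫ x, f x * (φ : UnitAddCircle → ℂ) x ∂haarAddCircle
     map_add' := fun φ ψ => by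
      rw [← integral_add (integrable_mul_smoothFun hf φ) (integrable_mul_smoothFun hf ψ)]
      simp [mul_add]
     map_smul' := fun c φ => by
      rw [RingHom.id_apply, smul_eq_mul, ← integral_const_mul]
      congr 1
      funext x
      simp only [Submodule.coe_smul, Pi.smul_apply, smul_eq_mul]
      ring },
    0, ∫ x, ‖f x‖ ∂haarAddCircle, fun φ B hB => by
      have hB' : ∀ x, ‖(φ : UnitAddCircle → ℂ) x‖ ≤ B := by
        intro x
        induction x using QuotientAddGroup.induction_on with
        | H x => simpa using hB 0 le_rfl x
      refine (norm_integral_le_of_norm_le (hf.norm.mul_const B)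
        (Filter.Eventually.of_forall fun x => ?_)).trans_eq (integral_mul_const _ _)
      rw [norm_mul]
      exact mul_le_mul_of_nonneg_left (hB' x) (norm_nonneg _)⟩

lemma coeff_ofIntegrable {f : UnitAddCircle → ℂ} (hf : Integrable f haarAddCircle) (n : ℤ) :
    coeff (distOfIntegrable f hf) n = fourierCoeff f n := by
  change ∫ x, f x * fourier (-n) x ∂haarAddCircle = ∫ x, fourier (-n) x • f x ∂haarAddCircle
  simp_rw [smul_eq_mul, mul_comm]

lemma isGivenBy_of_fourierCoeff_eq {u : Distribution} {f : UnitAddCircle → ℂ}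
    (hf : Integrable f haarAddCircle) (h : ∀ n, fourierCoeff f n = coeff u n) :
    IsGivenBy u f := by
  refine ⟨hf, fun φ => ?_⟩
  rw [distribution_ext_coeff (u := u) (v := distOfIntegrable f hf)
    fun n => by rw [coeff_ofIntegrable, h]]
  rfl

/-! ### Littlewood–Paley pieces as trigonometric polynomials -/

/-- The frequencies that occur in the `k`-th Littlewood–Paley piece. -/
def bandFreq (k : ℕ) : Finset ℤ :=
  (Finset.Icc (-2 ^ (k + 1)) (2 ^ (k + 1))).filter fun n => k ≠ 0 → 2 ^ (k - 1) ≤ |n|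

lemma bandLimited_bandFreq (k : ℕ) : BandLimited k (bandFreq k) := by
  intro n hn
  rw [bandFreq, Finset.mem_filter, Finset.mem_Icc] at hn
  exact ⟨abs_le.2 hn.1, hn.2⟩

lemma IsCutoff.eq_zero {Φ : ℝ → ℂ} (hΦ : IsCutoff Φ) {s : ℝ} (hs : 2 ≤ |s|) : Φ s = 0 := by
  by_contra h
  have h2 := hΦ.support_subset (Function.mem_support.2 h)
  exact absurd (abs_lt.2 h2) (not_lt.2 hs)

/-- For `k ≥ 1` and small `|n|` both terms of `φ_k(n)` equal `1`; for large `|n|` they vanish. -/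
lemma dyadic_eq_zero {Φ : ℝ → ℂ} (hΦ : IsCutoff Φ) {k : ℕ} {n : ℤ} (hn : n ∉ bandFreq k) :
    dyadic Φ k n = 0 := by
  rw [bandFreq, Finset.mem_filter, Finset.mem_Icc, ← abs_le] at hn
  have habs : ∀ i : ℕ, |(n : ℝ) / 2 ^ i| = |(n : ℝ)| / 2 ^ i := fun i => by
    rw [abs_div, abs_of_pos (show (0 : ℝ) < 2 ^ i by positivity)]
  by_cases h : |n| ≤ 2 ^ (k + 1)
  · have h2 : k ≠ 0 ∧ |n| < 2 ^ (k - 1) := by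
      by_contra hcon
      exact hn ⟨h, fun hk => not_lt.1 fun hlt => hcon ⟨hk, hlt⟩⟩
    obtain ⟨hk, h2⟩ := h2
    obtain ⟨k, rfl⟩ := Nat.exists_eq_succ_of_ne_zero hk
    have h3 : |(n : ℝ)| ≤ 2 ^ k := by exact_mod_cast h2.le
    rw [Nat.succ_eq_add_one, dyadic, hΦ.eq_one, hΦ.eq_one, sub_self]
    · rw [habs, div_le_one (by positivity)]
      exact h3
    · rw [habs, div_le_one (by positivity)]
      exact h3.trans (pow_le_pow_right₀ one_le_two (Nat.le_succ k))
  · have h3 : (2 : ℝ) ^ (k + 1) ≤ |(n : ℝ)| := by exact_mod_cast (not_le.1 h).le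
    cases k with
    | zero => exact hΦ.eq_zero (by simpa using h3)
    | succ k =>
      rw [dyadic, hΦ.eq_zero, hΦ.eq_zero, sub_self]
      · rw [habs, le_div_iff₀ (by positivity), ← pow_succ']
        exact (pow_le_pow_right₀ one_le_two (Nat.le_succ _)).trans h3
      · rw [habs, le_div_iff₀ (by positivity), ← pow_succ']
        exact h3

/-- The partition of unity `∑ φ_k = 1`, in telescoped form. -/
lemma sum_range_dyadic (Φ : ℝ → ℂ) (K : ℕ) (s : ℝ) :
    ∑ k ∈ Finset.range (K + 1), dyadic Φ k s = Φ (s / 2 ^ K) := by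
  induction K with
  | zero => simp [dyadic]
  | succ K ih =>
    rw [Finset.sum_range_succ, ih, dyadic]
    ring

lemma eventually_sum_range_dyadic {Φ : ℝ → ℂ} (hΦ : IsCutoff Φ) (s : ℝ) :
    ∀ᶠ K in Filter.atTop, ∑ k ∈ Finset.range K, dyadic Φ k s = 1 := by
  obtain ⟨K₀, hK₀⟩ := pow_unbounded_of_one_lt |s| one_lt_two
  filter_upwards [Filter.eventually_ge_atTop (K₀ + 1)] with K hK
  obtain ⟨K, rfl⟩ := Nat.exists_eq_add_of_le' (show 1 ≤ K by omega)
  rw [sum_range_dyadic]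
  refine hΦ.eq_one _ ?_
  rw [abs_div, abs_of_pos (show (0 : ℝ) < 2 ^ K by positivity), div_le_one (by positivity)]
  exact hK₀.le.trans (pow_le_pow_right₀ one_le_two (by omega))

/-- The `k`-th Littlewood–Paley piece of a distribution as a bundled continuous function. -/
def lpPieceC (Φ : ℝ → ℂ) (k : ℕ) (u : Distribution) : C(UnitAddCircle, ℂ) :=
  ∑ n ∈ bandFreq k, (dyadic Φ k n * coeff u n) • fourier n

lemma coe_lpPieceC {Φ : ℝ → ℂ} (hΦ : IsCutoff Φ) (k : ℕ) (u : Distribution) :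
    ⇑(lpPieceC Φ k u) = lpPiece Φ k u := by
  funext x
  rw [lpPiece, tsum_eq_sum (s := bandFreq k) fun n hn => by simp [dyadic_eq_zero hΦ hn], lpPieceC]
  simp [ContinuousMap.sum_apply]

lemma lpPieceC_eq_trigPoly (Φ : ℝ → ℂ) (k : ℕ) (u : Distribution) (x : ℝ) :
    lpPieceC Φ k u (x : UnitAddCircle)
      = trigPoly (bandFreq k) (fun n => dyadic Φ k n * coeff u n) x := by
  rw [lpPieceC, ContinuousMap.sum_apply]
  refine Finset.sum_congr rfl fun n _ => ?_
  rw [ContinuousMap.smul_apply, fourier_eq_expo, smul_eq_mul]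

lemma fourierCoeff_lpPieceC {Φ : ℝ → ℂ} (hΦ : IsCutoff Φ) (k : ℕ) (u : Distribution) (n : ℤ) :
    fourierCoeff (lpPieceC Φ k u) n = dyadic Φ k n * coeff u n := by
  have h1 : ⇑(lpPieceC Φ k u)
      = ∑ m ∈ bandFreq k, (dyadic Φ k m * coeff u m) • ⇑(fourier m : C(UnitAddCircle, ℂ)) := by
    funext x
    simp [lpPieceC, ContinuousMap.sum_apply]
  rw [h1, fourierCoeff.sum _ _ fun m _ => Continuous.integrable_of_hasCompactSupport
    ((map_continuous _).const_smul _) (.of_compactSpace _)]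
  have h2 : ∀ m : ℤ,
      fourierCoeff ((dyadic Φ k m * coeff u m) • ⇑(fourier m : C(UnitAddCircle, ℂ))) n
      = if m = n then dyadic Φ k n * coeff u n else 0 := by
    intro m
    rw [fourierCoeff.const_smul, fourierCoeff_fourier, Pi.single_apply]
    by_cases h : m = n
    · simp [h]
    · simp [h, Ne.symm h]
  rw [Finset.sum_apply, Finset.sum_congr rfl fun m _ => h2 m, Finset.sum_ite_eq']
  split_ifs with h
  · rfl
  · rw [dyadic_eq_zero hΦ h, zero_mul]

lemma eLpNorm_continuousMap_ne_top (g : C(UnitAddCircle, ℂ)) (p : ℝ≥0∞) :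
    eLpNorm g p haarAddCircle ≠ ⊤ :=
  (MemLp.of_bound g.continuous.aestronglyMeasurable ‖g‖
    (Filter.Eventually.of_forall g.norm_coe_le_norm)).eLpNorm_ne_top

/-- For a continuous function the essential supremum bounds every value. -/
lemma norm_le_eLpNorm_top (g : C(UnitAddCircle, ℂ)) (x : UnitAddCircle) :
    ‖g x‖ ≤ (eLpNorm g ⊤ haarAddCircle).toReal := by
  have hae : ∀ᵐ x ∂(haarAddCircle : Measure UnitAddCircle),
      ‖g x‖ ≤ (eLpNorm g ⊤ haarAddCircle).toReal := by
    filter_upwards [ae_le_eLpNormEssSup (f := g) (μ := haarAddCircle)] with y hy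
    rw [← toReal_enorm]
    exact ENNReal.toReal_mono (eLpNorm_continuousMap_ne_top g ⊤) (by rwa [eLpNorm_exponent_top])
  have hclosed : IsClosed {x | ‖g x‖ ≤ (eLpNorm g ⊤ haarAddCircle).toReal} :=
    isClosed_le (by fun_prop) continuous_const
  have := (Measure.dense_of_ae hae).closure_eq
  rw [hclosed.closure_eq] at this
  exact this.symm.subset (Set.mem_univ x)

/-! ### Convergence of the Littlewood–Paley series and the embedding -/

/-- The supremum norm of the `k`-th Littlewood–Paley piece. -/
def supPiece (Φ : ℝ → ℂ) (k : ℕ) (u : Distribution) : ℝ :=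
  (eLpNorm (lpPieceC Φ k u) ⊤ haarAddCircle).toReal

lemma supPiece_nonneg (Φ : ℝ → ℂ) (k : ℕ) (u : Distribution) : 0 ≤ supPiece Φ k u :=
  ENNReal.toReal_nonneg

lemma eLpNorm_sum_lpPieceC_le (Φ : ℝ → ℂ) {q : ℝ} (hq1 : 1 ≤ q) (hq2 : q ≤ 2) (u : Distribution)
    {p : ℝ} (hp : 1 ≤ p) (t : Finset ℕ) {α : ℝ} (hα : 0 < α)
    (hsum : ∑ k ∈ t, supPiece Φ k u ^ q ≤ α ^ q) :
    eLpNorm (∑ k ∈ t, lpPieceC Φ k u : C(UnitAddCircle, ℂ)) (ENNReal.ofReal p) haarAddCircle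
      ≤ ENNReal.ofReal (embConst * p ^ (1 - 1 / q) * α) := by
  have hK := embConst_pos
  refine eLpNorm_haarAddCircle_le (map_continuous _) (by linarith) (by positivity) ?_
  have h := integral_norm_sum_rpow_le hq1 hq2 hp t bandLimited_bandFreq
    (fun k n => dyadic Φ k n * coeff u n) (a := fun k => supPiece Φ k u) (fun k x => by
      rw [← lpPieceC_eq_trigPoly]
      exact norm_le_eLpNorm_top _ _) hα hsum
  simpa only [ContinuousMap.sum_apply, lpPieceC_eq_trigPoly] using h

lemma sum_supPiece_rpow_le {Φ : ℝ → ℂ} (hΦ : IsCutoff Φ) {q : ℝ} (hq : 0 < q) {u : Distribution}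
    {α : ℝ} (hα : 0 ≤ α) (h : besovNorm Φ q u ≤ ENNReal.ofReal α) (t : Finset ℕ) :
    ∑ k ∈ t, supPiece Φ k u ^ q ≤ α ^ q := by
  have h1 : ∑ k ∈ t, ENNReal.ofReal (supPiece Φ k u ^ q) ≤ ENNReal.ofReal (α ^ q) := by
    have h2 : ∀ k, ENNReal.ofReal (supPiece Φ k u ^ q)
        = eLpNorm (lpPiece Φ k u) ⊤ haarAddCircle ^ q := by
      intro k
      rw [← ENNReal.ofReal_rpow_of_nonneg (supPiece_nonneg _ _ _) hq.le, supPiece,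
        ENNReal.ofReal_toReal (eLpNorm_continuousMap_ne_top _ _), coe_lpPieceC hΦ]
    simp_rw [h2]
    refine (ENNReal.sum_le_tsum t).trans ?_
    rw [← ENNReal.ofReal_rpow_of_nonneg hα hq.le]
    refine le_trans (le_of_eq ?_) (ENNReal.rpow_le_rpow h hq.le)
    rw [besovNorm, ← ENNReal.rpow_mul, one_div_mul_cancel hq.ne', ENNReal.rpow_one]
  rw [← ENNReal.ofReal_sum_of_nonneg
    fun k _ => Real.rpow_nonneg (supPiece_nonneg _ _ _) _] at h1
  exact (ENNReal.ofReal_le_ofReal_iff (by positivity)).1 h1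

/-- The `k`-th Littlewood–Paley piece as an element of `L²(𝕋)`. -/
def lpPieceL2 (Φ : ℝ → ℂ) (k : ℕ) (u : Distribution) :
    Lp ℂ 2 (haarAddCircle : Measure UnitAddCircle) :=
  ContinuousMap.toLp (E := ℂ) 2 haarAddCircle ℂ (lpPieceC Φ k u)

/-- The Littlewood–Paley series of an element of `B^∞_{0,q}` converges unconditionally in `L²`, by
the `L²` case of the estimate applied to its tails. -/
lemma summable_lpPieceL2 (Φ : ℝ → ℂ) {q : ℝ} (hq1 : 1 ≤ q) (hq2 : q ≤ 2) {u : Distribution}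
    (hu : Summable fun k => supPiece Φ k u ^ q) : Summable fun k => lpPieceL2 Φ k u := by
  rw [summable_iff_vanishing_norm] at hu ⊢
  intro ε hε
  have hK := embConst_pos
  set D : ℝ := embConst * 2 ^ (1 - 1 / q) with hD
  have hD0 : 0 < D := by positivity
  set α : ℝ := ε / (2 * D) with hα
  have hα0 : 0 < α := by positivity
  obtain ⟨s, hs⟩ := hu (α ^ q) (by positivity)
  refine ⟨s, fun t ht => ?_⟩
  have h := eLpNorm_sum_lpPieceC_le Φ hq1 hq2 u one_le_two t hα0
    ((le_abs_self _).trans (hs t ht).le)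
  rw [ENNReal.ofReal_ofNat] at h
  simp_rw [lpPieceL2]
  rw [← map_sum, Lp.norm_def, eLpNorm_congr_ae (ContinuousMap.coeFn_toLp haarAddCircle _)]
  refine (ENNReal.toReal_le_of_le_ofReal (by positivity) h).trans_lt ?_
  rw [← hD, hα, mul_div_assoc', div_lt_iff₀ (by positivity)]
  nlinarith

lemma fourierCoeff_tsum_lpPieceL2 {Φ : ℝ → ℂ} (hΦ : IsCutoff Φ) {u : Distribution}
    (hu : Summable fun k => lpPieceL2 Φ k u) (n : ℤ) :
    fourierCoeff (∑' k, lpPieceL2 Φ k u : Lp ℂ 2 (haarAddCircle : Measure UnitAddCircle)) n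
      = coeff u n := by
  have h1 : ∀ g : Lp ℂ 2 (haarAddCircle : Measure UnitAddCircle),
      innerSL ℂ (fourierLp 2 n) g = fourierCoeff g n := by
    intro g
    rw [← fourierBasis_repr, HilbertBasis.repr_apply_apply, coe_fourierBasis]
    rfl
  have h2 := ((innerSL ℂ (fourierLp (T := 1) 2 n)).hasSum hu.hasSum).tendsto_sum_nat
  simp only [h1] at h2
  refine tendsto_nhds_unique h2 (tendsto_const_nhds.congr' ?_)
  filter_upwards [eventually_sum_range_dyadic hΦ n] with K hK
  have h3 : ∀ k, fourierCoeff (lpPieceL2 Φ k u) n = dyadic Φ k n * coeff u n := fun k => by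
    rw [lpPieceL2, fourierCoeff_toLp, fourierCoeff_lpPieceC hΦ]
  simp only [h3]
  rw [← Finset.sum_mul, hK, one_mul]

/-- The `L^p` bound passes to the sum of the Littlewood–Paley series by Fatou's lemma along an
almost everywhere convergent subsequence of its partial sums. -/
lemma eLpNorm_tsum_lpPieceL2_le (Φ : ℝ → ℂ) {q : ℝ} (hq1 : 1 ≤ q) (hq2 : q ≤ 2) {u : Distribution}
    (hu : Summable fun k => lpPieceL2 Φ k u) {p : ℝ} (hp : 1 ≤ p) {α : ℝ} (hα : 0 < α)
    (hsum : ∀ t : Finset ℕ, ∑ k ∈ t, supPiece Φ k u ^ q ≤ α ^ q) :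
    eLpNorm (∑' k, lpPieceL2 Φ k u : Lp ℂ 2 (haarAddCircle : Measure UnitAddCircle))
      (ENNReal.ofReal p) haarAddCircle ≤ ENNReal.ofReal (embConst * p ^ (1 - 1 / q) * α) := by
  have h1 := tendstoInMeasure_of_tendsto_Lp hu.hasSum.tendsto_sum_nat
  obtain ⟨ns, -, hns⟩ := h1.exists_seq_tendsto_ae
  refine Lp.eLpNorm_le_of_ae_tendsto (u := Filter.atTop) (Filter.Eventually.of_forall fun i => ?_)
    (fun i => Lp.aestronglyMeasurable _) hns
  simp_rw [lpPieceL2]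
  rw [← map_sum, eLpNorm_congr_ae (ContinuousMap.coeFn_toLp haarAddCircle _)]
  exact eLpNorm_sum_lpPieceC_le Φ hq1 hq2 u hp _ hα (hsum _)

lemma integrable_coe_L2 (f : Lp ℂ 2 (haarAddCircle : Measure UnitAddCircle)) :
    Integrable f haarAddCircle := (Lp.memLp f).integrable one_le_two

end TorusBesov

end

theorem theorem1p1 (Φ : ℝ → ℂ) (hΦ : TorusBesov.IsCutoff Φ) (q : ℝ) (hq1 : 1 < q) (hq2 : q ≤ 2) :
    ∃ C : ℝ≥0, ∀ u ∈ TorusBesov.besovSpace Φ q,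
      ∃ f : UnitAddCircle → ℂ,
        TorusBesov.IsGivenBy u f ∧
        TorusBesov.MemExpL (q / (q - 1)) f ∧
        TorusBesov.expLNorm (q / (q - 1)) f ≤ C * TorusBesov.besovNorm Φ q u := by
  have hq0 : 0 < q := by linarith
  refine ⟨TorusBesov.embConst.toNNReal, fun u hu => ?_⟩
  change TorusBesov.besovNorm Φ q u < ⊤ at hu
  -- The estimates need a positive bound for the norm of `u`; working with every `β` above that
  -- norm includes the case in which it vanishes.
  have hsum : ∀ β, TorusBesov.besovNorm Φ q u < β → β ≠ ⊤ → 0 < β.toReal ∧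
      ∀ t : Finset ℕ, ∑ k ∈ t, TorusBesov.supPiece Φ k u ^ q ≤ β.toReal ^ q := fun β hβ hβ' =>
    ⟨ENNReal.toReal_pos (ne_bot_of_gt hβ) hβ', TorusBesov.sum_supPiece_rpow_le hΦ hq0
      ENNReal.toReal_nonneg (by rw [ENNReal.ofReal_toReal hβ']; exact hβ.le)⟩
  obtain ⟨β₀, hβ₀, hβ₀'⟩ := exists_between hu
  have hsummable := TorusBesov.summable_lpPieceL2 Φ hq1.le hq2 (u := u)
    (summable_of_sum_le (fun k => Real.rpow_nonneg (TorusBesov.supPiece_nonneg _ _ _) _)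
      (hsum β₀ hβ₀ hβ₀'.ne).2)
  have hbound : TorusBesov.expLNorm (q / (q - 1)) (∑' k, TorusBesov.lpPieceL2 Φ k u :
      Lp ℂ 2 (haarAddCircle : Measure UnitAddCircle))
      ≤ TorusBesov.embConst.toNNReal * TorusBesov.besovNorm Φ q u := by
    refine iSup₂_le fun p hp => ?_
    have hp0 : 0 < p := by linarith
    have hK := TorusBesov.embConst_pos
    have hK0 : (TorusBesov.embConst.toNNReal : ℝ≥0∞) ≠ 0 := by simpa using hK
    rw [mul_comm (TorusBesov.embConst.toNNReal : ℝ≥0∞),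
      ← ENNReal.div_le_iff hK0 ENNReal.coe_ne_top]
    refine le_of_forall_gt_imp_ge_of_dense fun β hβ => ?_
    rcases eq_or_ne β ⊤ with rfl | hβ'
    · exact le_top
    rw [ENNReal.div_le_iff hK0 ENNReal.coe_ne_top]
    obtain ⟨hβ0, hβsum⟩ := hsum β hβ hβ'
    calc _ ≤ ENNReal.ofReal (p ^ (-(1 / (q / (q - 1)))))
          * ENNReal.ofReal (TorusBesov.embConst * p ^ (1 - 1 / q) * β.toReal) := by
          gcongr
          exact TorusBesov.eLpNorm_tsum_lpPieceL2_le Φ hq1.le hq2 hsummable hp hβ0 hβsum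
      _ = ENNReal.ofReal (β.toReal * TorusBesov.embConst) := by
          rw [← ENNReal.ofReal_mul (by positivity)]
          congr 1
          have h1 : 1 / (q / (q - 1)) = 1 - 1 / q := by
            field_simp
          have h2 : p ^ (-(1 - 1 / q)) * p ^ (1 - 1 / q) = 1 := by
            rw [← Real.rpow_add hp0, neg_add_cancel, Real.rpow_zero]
          rw [h1]
          linear_combination (TorusBesov.embConst * β.toReal) * h2
      _ = β * TorusBesov.embConst.toNNReal := by
          rw [ENNReal.ofReal_mul hβ0.le, ENNReal.ofReal_toReal hβ', ENNReal.ofReal]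
  refine ⟨_, TorusBesov.isGivenBy_of_fourierCoeff_eq (TorusBesov.integrable_coe_L2 _)
    (TorusBesov.fourierCoeff_tsum_lpPieceL2 hΦ hsummable),
    ⟨Lp.aestronglyMeasurable _, hbound.trans_lt (ENNReal.mul_lt_top ENNReal.coe_lt_top hu)⟩, hbound⟩
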